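/- Let $\mathbb{F}_q$ be a finite field with $q$ elements, $A=\mathbb{F}_q[\theta]$, and let $A_+\subset A$ be the set of monic polynomials. Let $\phi$ be a Drinfeld $A$-module over $A$ of rank $r\ge 1$, given by $\phi_\theta=\sum_{i=0}^r\phi_{\theta,i}\tau^i$ with $\phi_{\theta,i}\in A$, $\phi_{\theta,0}=\theta$, $\phi_{\theta,r}\neq 0$. *The function $\mu$.* Let $f\in A_+$ be irreducible of degree $d$, and let $\overline{\phi}$ be the reduction of $\phi$ modulo $f$, acting on an algebraic closure of $A/fA$ with $\tau(x)=x^q$. For $h\in A_+$ irreducible, $h\ne f$, let $T_h(\overline{\phi})=\varprojlim_k\overline{\phi}[h^k]$ be the Tate module, which is free of finite rank $r_0$ over the $h$-adic completion of $A$. The characteristic polynomial of $\tau^d$ on $T_h(\overline{\phi})$ is a polynomial $P_f(x)=x^{r_0}+p_{r_0-1}x^{r_0-1}+\dots+p_0\in A[x]$ independent of $h$, and, if $r_0\geq 1$, $p_0=c(f)^{-1}f$ with $c(f)\in\mathbb{F}_q^\times$. Put $D_f(x)=1+\sum_{i=1}^{r_0}c(f)\,p_i\,f^{i-1}x^i$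 (so $D_f=1$ if $r_0=0$). Then $\mu\colon A_+\to A$ is the multiplicative function with $\sum_{i\ge0}\mu(f^i)x^i=D_f(x)^{-1}$ in $A[[x]]$ for every irreducible $f\in A_+$. *The module $\psi$.* Let $n\ge 0$, let $z_1,\dots,z_n,t$ be indeterminates, $k=\mathbb{F}_q(z_1,\dots,z_n,t)$ and $\tilde{\mathbb{A}}=k[\theta]$, and let $\tau$ be the $k$-algebra endomorphism of $\tilde{\mathbb{A}}$ with $\tau(\theta)=\theta^q$. For $i\ge0$ put $\ell_i(z)=\prod_{j=0}^{i-1}(z-\theta^{q^j})$. Let $\psi$ be the Drinfeld $\tilde{\mathbb{A}}$-module with $$\psi_\theta=\sum_{i=0}^r t^i\ell_i(z_1)\cdots\ell_i(z_n)\phi_{\theta,i}\tau^i .$$ For $f\in A_+$ irreducible, let $\psi(\tilde{\mathbb{A}}/f\tilde{\mathbb{A}})$ be $\tilde{\mathbb{A}}/f\tilde{\mathbb{A}}$ with $\theta$ acting through $\psi_\theta$. For a $k[\theta]$-module $M$ of finite dimension over $k$, let $[M]_{\tilde{\mathbb{A}}}\in k[\theta]$ be the monic generator of its Fitting ideal,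 that is, the characteristic polynomial of the action of $\theta$ on $M$ evaluated at $\theta$. Then the infinite product defining the Taelman $L$-value of $\psi$ and the series below converge (unconditionally) in $k((\theta^{-1}))$, and $$L(\psi,\tilde{\mathbb{A}}):=\prod_{f\in A_+\text{ irreducible}}\frac{[\tilde{\mathbb{A}}/f\tilde{\mathbb{A}}]_{\tilde{\mathbb{A}}}}{[\psi(\tilde{\mathbb{A}}/f\tilde{\mathbb{A}})]_{\tilde{\mathbb{A}}}}=\sum_{a\in A_+}\frac{\mu(a)\,a(z_1)\cdots a(z_n)\,t^{\deg_\theta a}}{a}.$$ -/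

import Mathlib

open Polynomial

noncomputable section

namespace TaelmanL

/-! Throughout, `F` is the finite field `𝔽_q`, `q = Fintype.card F`, the ring `A = 𝔽_q[θ]` is
`F[X]` with `X` in the role of `θ`, and likewise `k[θ]` is `k[X]` for every field `k`. -/

section Basic

variable (F : Type*) [Field F]

/-- The set `A₊` of monic polynomials. -/
abbrev MonicPoly := {a : F[X] // a.Monic}

/-- The irreducible elements of `A₊`. -/
abbrev MonicIrred := {f : F[X] // f.Monic ∧ Irreducible f}

instance (f : MonicIrred F) : Fact (Irreducible f.1) := ⟨f.2.2⟩

/-- A Drinfeld `A`-module over `A`, given by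
`φ_θ = θ + φ_{θ,1} τ + ⋯ + φ_{θ,r} τ ^ r` with `φ_{θ,r} ≠ 0`. As `A` is freely generated by `θ` as
an `𝔽_q`-algebra, `φ_θ` determines the homomorphism `φ : A → A{τ}`. -/
structure DrinfeldModule where
  /-- the rank `r` -/
  rank : ℕ
  /-- the coefficients `φ_{θ,i}` -/
  coeff : ℕ → F[X]
  rank_pos : 0 < rank
  coeff_zero : coeff 0 = X
  coeff_rank : coeff rank ≠ 0
  coeff_of_gt : ∀ i, rank < i → coeff i = 0

end Basic

/-- The action on `R` of the skew polynomial `c₀ + c₁ τ + ⋯ + c_r τ ^ r ∈ R{τ}`. -/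
def skewOp {k R : Type*} [CommRing k] [CommRing R] [Algebra k R] (τ : R →ₐ[k] R) (r : ℕ)
    (c : ℕ → R) : Module.End k R :=
  ∑ i ∈ Finset.range (r + 1), LinearMap.mulLeft k (c i) * τ.toLinearMap ^ i

/-- The monic generator `[M]_{k[θ]}` of the Fitting ideal of a `k[θ]`-module `M` of finite dimension
over the field `k`: the characteristic polynomial of the action of `θ`, evaluated at `θ`. -/
def fittingGen (k M : Type*) [Field k] [AddCommGroup M] [Module k M] [Module k[X] M]
    [IsScalarTower k k[X] M] [Module.Finite k M] : k[X] :=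
  (Algebra.lsmul k k M (X : k[X])).charpoly

/-! ### Tate modules -/

section Tate

variable {R : Type*} [CommRing R] (N : Type*) [AddCommGroup N] [Module R N] (h : R)

/-- The `h`-adic Tate module `lim N[h ^ k]` of an `R`-module `N`, the transition maps
`N[h ^ (k + 1)] → N[h ^ k]` being multiplication by `h`. -/
def tateModule : Submodule R (ℕ → N) where
  carrier := {x | x 0 = 0 ∧ ∀ k, h • x (k + 1) = x k}
  add_mem' := by
    rintro x y ⟨hx, hx'⟩ ⟨hy, hy'⟩
    exact ⟨by simp [hx, hy], fun k => by simp [smul_add, hx', hy']⟩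
  zero_mem' := by simp
  smul_mem' := by
    rintro a x ⟨hx, hx'⟩
    exact ⟨by simp [hx], fun k => by simp [smul_comm h a, hx']⟩

variable {N h}

theorem tateModule_pow_smul (x : tateModule N h) (k : ℕ) : h ^ k • x.1 k = 0 := by
  induction k with
  | zero => simpa using x.2.1
  | succ k ih => rw [pow_succ, mul_smul, x.2.2 k, ih]

theorem tateModule_smul_eq_zero (x : tateModule N h) (k : ℕ) {a : R}
    (ha : a ∈ (Ideal.span {h} ^ k • ⊤ : Ideal R)) : a • x.1 k = 0 := by
  rw [smul_eq_mul, Ideal.mul_top, Ideal.span_singleton_pow, Ideal.mem_span_singleton] at ha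
  obtain ⟨b, rfl⟩ := ha
  rw [mul_comm, mul_smul, tateModule_pow_smul, smul_zero]

/-- The map `R / h ^ k → N`, `a ↦ a • x_k`, for `x` in the Tate module. -/
def levelSMul (x : tateModule N h) (k : ℕ) : (R ⧸ (Ideal.span {h} ^ k • ⊤ : Ideal R)) →ₗ[R] N :=
  Submodule.liftQ _ (LinearMap.toSpanSingleton R N (x.1 k))
    (fun _ ha => by simpa using tateModule_smul_eq_zero x k ha)

theorem levelSMul_mk (x : tateModule N h) (k : ℕ) (a : R) :
    levelSMul x k (Ideal.Quotient.mk _ a) = a • x.1 k := rfl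

/-- The Tate module is a module over the `h`-adic completion of `R`: `(α • x)_k = α_k • x_k`, where
`α_k` is the class of `α` modulo `h ^ k`. -/
instance : SMul (AdicCompletion (Ideal.span {h}) R) (tateModule N h) where
  smul α x := ⟨fun k => levelSMul x k (α.1 k), by
    constructor
    · obtain ⟨a, ha⟩ := Ideal.Quotient.mk_surjective (α.1 0)
      simp only
      rw [← ha, levelSMul_mk, x.2.1, smul_zero]
    · intro k
      obtain ⟨a, ha⟩ := Ideal.Quotient.mk_surjective (α.1 (k + 1))
      have hk : α.1 k = Ideal.Quotient.mk _ a := by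
        have e := α.2 (Nat.le_add_right k 1)
        rw [← ha] at e
        exact e.symm
      simp only
      rw [hk, ← ha, levelSMul_mk, levelSMul_mk, smul_comm, x.2.2 k]⟩

theorem adic_smul_apply (α : AdicCompletion (Ideal.span {h}) R) (x : tateModule N h) (k : ℕ) :
    (α • x).1 k = levelSMul x k (α.1 k) := rfl

theorem adic_smul_apply_of_mk {α : AdicCompletion (Ideal.span {h}) R} {k : ℕ} {a : R}
    (ha : Ideal.Quotient.mk _ a = α.1 k) (x : tateModule N h) : (α • x).1 k = a • x.1 k := by
  rw [adic_smul_apply, ← ha, levelSMul_mk]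

instance : Module (AdicCompletion (Ideal.span {h}) R) (tateModule N h) where
  one_smul x := by
    ext k
    rw [adic_smul_apply_of_mk (a := 1) rfl, one_smul]
  mul_smul α β x := by
    ext k
    obtain ⟨a, ha⟩ := Ideal.Quotient.mk_surjective (α.1 k)
    obtain ⟨b, hb⟩ := Ideal.Quotient.mk_surjective (β.1 k)
    rw [adic_smul_apply_of_mk (a := a * b) (by rw [map_mul, ha, hb]; rfl),
      adic_smul_apply_of_mk ha, adic_smul_apply_of_mk hb, mul_smul]
  smul_zero α := by
    ext k
    obtain ⟨a, ha⟩ := Ideal.Quotient.mk_surjective (α.1 k)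
    rw [adic_smul_apply_of_mk ha]
    simp
  smul_add α x y := by
    ext k
    obtain ⟨a, ha⟩ := Ideal.Quotient.mk_surjective (α.1 k)
    have e : ((α • x + α • y : tateModule N h)).1 k = (α • x).1 k + (α • y).1 k := rfl
    have e' : ((x + y : tateModule N h)).1 k = x.1 k + y.1 k := rfl
    rw [e, adic_smul_apply_of_mk ha, adic_smul_apply_of_mk ha, adic_smul_apply_of_mk ha, e',
      smul_add]
  add_smul α β x := by
    ext k
    obtain ⟨a, ha⟩ := Ideal.Quotient.mk_surjective (α.1 k)
    obtain ⟨b, hb⟩ := Ideal.Quotient.mk_surjective (β.1 k)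
    have e : ((α • x + β • x : tateModule N h)).1 k = (α • x).1 k + (β • x).1 k := rfl
    rw [e, adic_smul_apply_of_mk (a := a + b) (by rw [map_add, ha, hb]; rfl),
      adic_smul_apply_of_mk ha, adic_smul_apply_of_mk hb, add_smul]
  zero_smul x := by
    ext k
    rw [adic_smul_apply_of_mk (a := 0) rfl, zero_smul]
    rfl

/-- The endomorphism of the Tate module induced by an endomorphism of `N`. -/
def tateMap (h : R) (u : N →ₗ[R] N) :
    tateModule N h →ₗ[AdicCompletion (Ideal.span {h}) R] tateModule N h where
  toFun x := ⟨fun k => u (x.1 k), by simp [x.2.1], fun k => by rw [← map_smul, x.2.2 k]⟩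
  map_add' x y := by
    ext k
    exact map_add u (x.1 k) (y.1 k)
  map_smul' α x := by
    ext k
    obtain ⟨a, ha⟩ := Ideal.Quotient.mk_surjective (α.1 k)
    rw [RingHom.id_apply, adic_smul_apply_of_mk ha]
    change u ((α • x).1 k) = _
    rw [adic_smul_apply_of_mk ha, map_smul]

end Tate

/-! ### The reduction of `φ` and the function `μ` -/

section Reduction

variable {F : Type*} [Field F] [Fintype F] (φ : DrinfeldModule F) (f : MonicIrred F)

/-- An algebraic closure of `A / f A`. -/
abbrev ResClosure := AlgebraicClosure (AdjoinRoot f.1)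

/-- The map `τ : x ↦ x ^ q` on the algebraic closure of `A / f A`. -/
abbrev resFrob : ResClosure f →ₐ[F] ResClosure f :=
  FiniteField.frobeniusAlgHom F (ResClosure f)

/-- The action of `φ_θ` reduced modulo `f` on the algebraic closure of `A / f A`. -/
def redOp : Module.End F (ResClosure f) :=
  skewOp (resFrob f) φ.rank
    (fun i => algebraMap (AdjoinRoot f.1) (ResClosure f) (AdjoinRoot.mk f.1 (φ.coeff i)))

theorem pow_card_pow (c : AdjoinRoot f.1) : c ^ Fintype.card F ^ f.1.natDegree = c := by
  have hfin : Module.Finite F (AdjoinRoot f.1) := f.2.1.finite_adjoinRoot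
  have : Finite (AdjoinRoot f.1) := Module.finite_of_finite F
  have : Fintype (AdjoinRoot f.1) := Fintype.ofFinite _
  have hr : Module.finrank F (AdjoinRoot f.1) = f.1.natDegree := by
    rw [(AdjoinRoot.powerBasis' f.2.1).finrank, AdjoinRoot.powerBasis'_dim]
  have hc : Fintype.card (AdjoinRoot f.1) = Fintype.card F ^ f.1.natDegree := by
    rw [← hr, Module.card_eq_pow_finrank (K := F)]
  rw [← hc, FiniteField.pow_card]

theorem resFrob_pow_apply (m : ℕ) (x : ResClosure f) :
    ((resFrob f).toLinearMap ^ m) x = x ^ Fintype.card F ^ m := by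
  induction m generalizing x with
  | zero => simp
  | succ m ih =>
    rw [pow_succ, Module.End.mul_apply, ih]
    simp [← pow_mul, pow_succ, mul_comm]

theorem redOp_frob (x : ResClosure f) :
    ((resFrob f).toLinearMap ^ f.1.natDegree) (redOp φ f x) =
      redOp φ f (((resFrob f).toLinearMap ^ f.1.natDegree) x) := by
  simp only [redOp, skewOp, LinearMap.sum_apply, map_sum, Module.End.mul_apply,
    LinearMap.mulLeft_apply]
  refine Finset.sum_congr rfl fun i _ => ?_
  rw [resFrob_pow_apply, resFrob_pow_apply, resFrob_pow_apply, resFrob_pow_apply, mul_pow,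
    ← map_pow, pow_card_pow]
  rw [← pow_mul, ← pow_mul, mul_comm (Fintype.card F ^ i)]

/-- The algebraic closure of `A / f A` as an `A`-module through the reduction of `φ`
modulo `f`. -/
abbrev RedModule := Module.AEval' (redOp φ f)

/-- The `A`-linear endomorphism `τ ^ d`, `d = deg f`, of the algebraic closure of `A / f A`, where
`A` acts through the reduction of `φ`. -/
def frobEnd : RedModule φ f →ₗ[F[X]] RedModule φ f :=
  LinearMap.ofAEval _ ((Module.AEval'.of (redOp φ f)).toLinearMap ∘ₗ
    ((resFrob f).toLinearMap ^ f.1.natDegree)) (fun m => by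
      rw [LinearMap.comp_apply, LinearMap.comp_apply, LinearEquiv.coe_coe,
        Module.AEval'.X_smul_of]
      exact congrArg _ (redOp_frob φ f m))

/-- `P ∈ A[x]` is the characteristic polynomial of `τ ^ d` on the Tate module `T_h` of the reduction
of `φ` modulo `f`; this includes that the Tate module is free of finite rank over `A_h`. -/
def IsFrobCharpoly (h : MonicIrred F) (P : F[X][X]) : Prop :=
  ∃ (m : ℕ) (b : Module.Basis (Fin m) (AdicCompletion (Ideal.span {h.1}) F[X])
      (tateModule (RedModule φ f) h.1)),
    (LinearMap.toMatrix b b (tateMap h.1 (frobEnd φ f))).charpoly =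
      P.map (algebraMap F[X] (AdicCompletion (Ideal.span {h.1}) F[X]))

open Classical in
/-- The characteristic polynomial `P_φ(x) = x ^ r₀ + ⋯ + p₁ x + p₀ ∈ A[x]` of `τ ^ d` on the Tate
modules `T_h`, for `h ≠ f` monic irreducible; it is independent of `h`. -/
def frobPoly : F[X][X] :=
  if H : ∃ P : F[X][X], ∀ h : MonicIrred F, h ≠ f → IsFrobCharpoly φ f h P then H.choose else 0

/-- The constant `c(f) ∈ 𝔽_q` for which `p₀ = c(f)⁻¹ f`; as `f` is monic, `c(f)⁻¹` is the leading
coefficient of `p₀`. -/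
def frobConst : F := ((frobPoly φ f).coeff 0).leadingCoeff⁻¹

/-- The polynomial
`D_f(x) = 1 + c(f) p₁ x + c(f) p₂ f x ^ 2 + ⋯ + c(f) f ^ (r₀ - 1) x ^ r₀ ∈ A[x]`.
It is `1` for `r₀ = 0`. -/
def eulerPoly : F[X][X] :=
  1 + ∑ i ∈ Finset.Icc 1 (frobPoly φ f).natDegree,
    C (C (frobConst φ f) * (frobPoly φ f).coeff i * f.1 ^ (i - 1)) * X ^ i

/-- The inverse of `D_f(x)` in `A⟦x⟧`; the constant term of `D_f` is `1`. -/
def eulerSeries : PowerSeries F[X] :=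
  PowerSeries.invOfUnit (eulerPoly φ f : PowerSeries F[X]) 1

/-- The function `μ : A₊ → A` with `∑ μ(a) a ^ (-s) = ∏_f D_f(f ^ (-s)) ⁻¹`, that is, the
multiplicative function whose values at the powers of `f` are given by
`∑ μ(f ^ i) x ^ i = D_f(x) ⁻¹`. -/
def mu (a : MonicPoly F) : F[X] :=
  ∏ᶠ f : MonicIrred F, PowerSeries.coeff (multiplicity f.1 a.1) (eulerSeries φ f)

end Reduction

/-! ### The Drinfeld module `ψ` and its Taelman `L`-value -/

section Psi

variable (F : Type*) [Field F] (n : ℕ)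

/-- The field `𝔽_q(z₁, …, z_n, t)`. -/
abbrev BaseField := FractionRing (MvPolynomial (Fin n ⊕ Unit) F)

/-- The variable `z_j`. -/
def zVar (j : Fin n) : BaseField F n :=
  algebraMap (MvPolynomial (Fin n ⊕ Unit) F) _ (MvPolynomial.X (Sum.inl j))

/-- The variable `t`. -/
def tVar : BaseField F n :=
  algebraMap (MvPolynomial (Fin n ⊕ Unit) F) _ (MvPolynomial.X (Sum.inr ()))

variable {F}

/-- The inclusion of `A = 𝔽_q[θ]` into `𝔽_q(z₁, …, z_n, t)[θ]`. -/
abbrev baseChange (a : F[X]) : (BaseField F n)[X] := a.map (algebraMap F (BaseField F n))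

variable [Fintype F]

/-- `ℓ_i(z) = ∏_{j < i} (z - θ ^ (q ^ j))`, for `z` in `𝔽_q(z₁, …, z_n, t)`. -/
def ell (i : ℕ) (z : BaseField F n) : (BaseField F n)[X] :=
  ∏ j ∈ Finset.range i, (C z - X ^ Fintype.card F ^ j)

/-- The coefficient `ψ_{θ,i} = t ^ i ℓ_i(z₁) ⋯ ℓ_i(z_n) φ_{θ,i}`. -/
def psiCoeff (φ : DrinfeldModule F) (i : ℕ) : (BaseField F n)[X] :=
  C (tVar F n ^ i) * (∏ j : Fin n, ell n i (zVar F n j)) * baseChange n (φ.coeff i)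

/-- The ideal generated by `f` in `𝔽_q(z₁, …, z_n, t)[θ]`. -/
abbrev primeIdeal (f : MonicIrred F) : Ideal (BaseField F n)[X] := Ideal.span {baseChange n f.1}

/-- The quotient of `𝔽_q(z₁, …, z_n, t)[θ]` by `f`. -/
abbrev PrimeQuot (f : MonicIrred F) := (BaseField F n)[X] ⧸ primeIdeal n f

instance (f : MonicIrred F) : Module.Finite (BaseField F n) (PrimeQuot n f) :=
  (f.2.1.map _).finite_quotient

/-- The endomorphism `τ` of `𝔽_q(z₁, …, z_n, t)[θ]`, linear over `𝔽_q(z₁, …, z_n, t)` with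
`τ(θ) = θ ^ q`. -/
abbrev polyFrob : (BaseField F n)[X] →ₐ[BaseField F n] (BaseField F n)[X] :=
  Polynomial.expand (BaseField F n) (Fintype.card F)

theorem polyFrob_baseChange (a : F[X]) :
    polyFrob n (baseChange n a) = baseChange n a ^ Fintype.card F := by
  rw [polyFrob, baseChange, ← Polynomial.map_expand, FiniteField.expand_card, Polynomial.map_pow]

/-- The endomorphism induced by `τ` on the quotient by `f`. -/
def quotFrob (f : MonicIrred F) : PrimeQuot n f →ₐ[BaseField F n] PrimeQuot n f :=
  Ideal.quotientMapₐ (primeIdeal n f) (polyFrob n) (by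
    rw [Ideal.span_singleton_le_iff_mem, Ideal.mem_comap]
    change polyFrob n (baseChange n f.1) ∈ _
    rw [polyFrob_baseChange]
    exact Ideal.pow_mem_of_mem _ (Ideal.mem_span_singleton_self _) _ Fintype.card_pos)

/-- The action of `ψ_θ = ∑ ψ_{θ,i} τ ^ i` on the quotient by `f`. -/
def psiOp (φ : DrinfeldModule F) (f : MonicIrred F) :
    Module.End (BaseField F n) (PrimeQuot n f) :=
  skewOp (quotFrob n f) φ.rank (fun i => Ideal.Quotient.mk (primeIdeal n f) (psiCoeff n φ i))

/-- The `𝔽_q(z₁, …, z_n, t)[θ]`-module given by the quotient by `f` with the action of `ψ`. -/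
abbrev PsiModule (φ : DrinfeldModule F) (f : MonicIrred F) := Module.AEval' (psiOp n φ f)

/-- The inclusion of `k[θ]` into `k((θ⁻¹))`; the variable of the Laurent series is `θ⁻¹`, and
`k((θ⁻¹))` carries the corresponding valuation topology. -/
def toLaurent (k : Type*) [Field k] : k[X] →ₐ[k] LaurentSeries k :=
  Polynomial.aeval (HahnSeries.single (-1 : ℤ) (1 : k) : LaurentSeries k)

/-- The factor at `f` of the product defining the Taelman `L`-value of `ψ`. -/
def taelmanFactor (φ : DrinfeldModule F) (f : MonicIrred F) : LaurentSeries (BaseField F n) :=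
  toLaurent (BaseField F n) (fittingGen (BaseField F n) (PrimeQuot n f)) /
    toLaurent (BaseField F n) (fittingGen (BaseField F n) (PsiModule n φ f))

/-- The Taelman `L`-value of `ψ`. -/
def taelmanLValue (φ : DrinfeldModule F) : LaurentSeries (BaseField F n) :=
  ∏' f : MonicIrred F, taelmanFactor n φ f

/-- The term `μ(a) a(z₁) ⋯ a(z_n) t ^ deg a / a`. -/
def seriesTerm (φ : DrinfeldModule F) (a : MonicPoly F) : LaurentSeries (BaseField F n) :=
  toLaurent (BaseField F n) (baseChange n (mu φ a) *
      C ((∏ j : Fin n, aeval (zVar F n j) a.1) * tVar F n ^ a.1.natDegree)) /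
    toLaurent (BaseField F n) (baseChange n a.1)

end Psi

end TaelmanL

end

/-!
Skew polynomials in `τ` form a free module of rank `d` over the polynomials in `x = τ ^ d`, and the
determinant of `T - φ_θ` on it is, up to a nonzero constant, the characteristic polynomial `P_f(x)`
of `τ ^ d` on the Tate modules of the reduction of `φ` at `f`. Indeed, `T - φ_θ` annihilates the
Anderson generating functions of a basis of the `h ^ k`-torsion; their twists span, and `τ ^ d` acts
on them through the matrix of the Frobenius, so that modulo `h ^ k` the characteristic polynomial of
this matrix divides the determinant, and both have the same degree in `x`. On `Ã / f Ã`, extended to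
an algebraic closure of the constants, `ψ_θ` has the same matrix, with `x` specialised to
`t ^ d f(z₁) ⋯ f(z_n)`. Hence the factor at `f` of the Taelman `L`-value is
`D_f(t ^ d f(z₁) ⋯ f(z_n) / f)⁻¹`.

If `T` has weight `r` and `x` has weight `d`, the determinant has weight at most `r d`. This bounds
the degrees of the coefficients of `D_f` and gives `deg μ(a) ≤ (1 - 1 / r) deg a`. So the series
converges, and the Euler product, expanded by unique factorization, converges to its sum.
-/

noncomputable section

namespace TaelmanL

/-! ### Determinants and characteristic polynomials -/

section LinearAlgebra

theorem natDegree_det_le {R n : Type*} [CommRing R] [Fintype n] [DecidableEq n]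
    (M : Matrix n n R[X]) (r : ℕ) (h : ∀ i j, (M i j).natDegree ≤ r) :
    M.det.natDegree ≤ Fintype.card n * r := by
  rw [Matrix.det_apply]
  refine natDegree_sum_le_of_forall_le _ _ fun σ _ => ?_
  refine (natDegree_smul_le _ _).trans ((natDegree_prod_le _ _).trans ?_)
  simpa using Finset.sum_le_card_nsmul Finset.univ _ r fun i _ => h (σ i) i

theorem coeff_det_card_mul {R n : Type*} [CommRing R] [Fintype n] [DecidableEq n]
    (M : Matrix n n R[X]) (r : ℕ) (h : ∀ i j, (M i j).natDegree ≤ r) :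
    M.det.coeff (Fintype.card n * r) = (M.map fun p => p.coeff r).det := by
  rw [Matrix.det_apply, Matrix.det_apply, finsetSum_coeff]
  refine Finset.sum_congr rfl fun σ _ => ?_
  rw [coeff_smul]
  congr 1
  exact coeff_prod_of_natDegree_le _ _ r fun i _ => h (σ i) i

theorem det_eq_of_mul_eq {R n : Type*} [CommRing R] [IsDomain R] [Fintype n] [DecidableEq n]
    {W D E : Matrix n n R} (hW : W.det ≠ 0) (h : W * D = E * W) : D.det = E.det := by
  have hdet := congrArg Matrix.det h
  rw [Matrix.det_mul, Matrix.det_mul, mul_comm E.det] at hdet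
  exact mul_left_cancel₀ hW hdet

theorem charpoly_eq_of_mul_eq {R n : Type*} [CommRing R] [IsDomain R] [Fintype n] [DecidableEq n]
    {W D E : Matrix n n R} (hW : W.det ≠ 0) (h : W * D = E * W) : D.charpoly = E.charpoly := by
  refine det_eq_of_mul_eq (W := C.mapMatrix W) ?_ ?_
  · rw [← RingHom.map_det]
    exact C_ne_zero.mpr hW
  · rw [Matrix.charmatrix, Matrix.charmatrix, mul_sub, sub_mul, ← map_mul, ← map_mul, h]
    congr 1
    exact ((Matrix.scalar_commute X (fun _ => Commute.all _ _) _).eq).symm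

theorem charpoly_map_eq_of_apply_eq_sum {R L M n : Type*} [CommRing R] [Nontrivial R] [CommRing L]
    [IsDomain L] [Algebra R L] [AddCommGroup M] [Module R M] [Module.Free R M] [Module.Finite R M]
    [Fintype n] [DecidableEq n] (b : Module.Basis n R M) {u : Module.End R M} {l : n → M →ₗ[R] L}
    (hl : (Matrix.of fun j k => l j (b k)).det ≠ 0) {E : Matrix n n L}
    (hE : ∀ j w, l j (u w) = ∑ k, E j k * l k w) :
    u.charpoly.map (algebraMap R L) = E.charpoly := by
  rw [← LinearMap.charpoly_toMatrix u b, ← Matrix.charpoly_map]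
  refine charpoly_eq_of_mul_eq hl ?_
  ext j k
  simp only [Matrix.mul_apply, Matrix.of_apply, Matrix.map_apply]
  rw [← hE]
  conv_rhs => rw [← b.sum_repr (u (b k)), map_sum]
  refine Finset.sum_congr rfl fun i _ => ?_
  rw [LinearMap.toMatrix_apply, map_smul, Algebra.smul_def, mul_comm]

theorem sum_mul_apply_smul {R M l m n : Type*} [Semiring R] [AddCommMonoid M] [Module R M]
    [Fintype m] [Fintype n] (P : Matrix l m R) (Q : Matrix m n R) (w : n → M) (i : l) :
    ∑ k, (P * Q) i k • w k = ∑ j, P i j • ∑ k, Q j k • w k := by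
  simp only [Matrix.mul_apply, Finset.sum_smul, Finset.smul_sum, mul_smul]
  exact Finset.sum_comm

variable {S M ι κ : Type*} [CommRing S] [AddCommGroup M] [Fintype ι] [DecidableEq ι]

theorem exists_charmatrix_mul_add_map_C_eq (A : Matrix ι ι S) (P : Matrix ι ι S[X]) :
    ∃ (Q : Matrix ι ι S[X]) (W : Matrix ι ι S), A.charmatrix * Q + W.map C = P := by
  obtain _ | _ := subsingleton_or_nontrivial (Matrix ι ι S)
  · exact ⟨0, 0, matPolyEquiv.injective (Subsingleton.elim _ _)⟩
  set p := matPolyEquiv P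
  have hrem : p %ₘ (X - C A) = C ((p %ₘ (X - C A)).coeff 0) :=
    eq_C_of_natDegree_eq_zero (Nat.lt_one_iff.mp
      ((natDegree_modByMonic_lt p (monic_X_sub_C A) fun h => by
        simpa using congrArg natDegree h).trans_eq (natDegree_X_sub_C A)))
  refine ⟨matPolyEquiv.symm (p /ₘ (X - C A)), (p %ₘ (X - C A)).coeff 0, matPolyEquiv.injective ?_⟩
  rw [map_add, map_mul, Matrix.matPolyEquiv_charmatrix, AlgEquiv.apply_symm_apply,
    matPolyEquiv_map_C, ← hrem, add_comm, modByMonic_add_div]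

variable [Module S M] [Module S[X] M] [IsScalarTower S S[X] M]

theorem sum_charmatrix_smul (b : Module.Basis ι S M) (j : ι) :
    ∑ i, (LinearMap.toMatrix b b (Algebra.lsmul S S M (X : S[X]))).charmatrix i j • b i = 0 := by
  have hX : ∑ i, LinearMap.toMatrix b b (Algebra.lsmul S S M (X : S[X])) i j • b i =
      (X : S[X]) • b j := by
    simp only [LinearMap.toMatrix_apply]
    exact b.sum_repr _
  simp only [Matrix.charmatrix_apply, sub_smul, Finset.sum_sub_distrib, Matrix.diagonal_apply,
    ite_smul, zero_smul, Finset.sum_ite_eq', Finset.mem_univ, if_true]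
  rw [sub_eq_zero, ← hX]
  exact Finset.sum_congr rfl fun i _ => (algebraMap_smul S[X] _ (b i)).symm

theorem exists_charmatrix_mul_eq (b : Module.Basis ι S M) (P : Matrix ι κ S[X])
    (hP : ∀ j, ∑ i, P i j • b i = 0) :
    ∃ Q : Matrix ι κ S[X],
      (LinearMap.toMatrix b b (Algebra.lsmul S S M (X : S[X]))).charmatrix * Q = P := by
  set A := LinearMap.toMatrix b b (Algebra.lsmul S S M (X : S[X]))
  suffices h : ∀ j, ∃ γ : ι → S[X], A.charmatrix.mulVec γ = fun i => P i j by
    choose γ hγ using h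
    exact ⟨Matrix.of fun i j => γ j i, Matrix.ext fun i j => congrFun (hγ j) i⟩
  intro j
  obtain _ | ⟨⟨i₀⟩⟩ := isEmpty_or_nonempty ι
  · exact ⟨0, Subsingleton.elim _ _⟩
  obtain ⟨Q, W, hQW⟩ := exists_charmatrix_mul_add_map_C_eq A (Matrix.of fun i _ => P i j)
  have hcol : ∀ i, P i j = (A.charmatrix * Q) i i₀ + C (W i i₀) := fun i =>
    (congrFun (congrFun hQW i) i₀).symm
  have hrel : ∑ i, (A.charmatrix * Q) i i₀ • b i = 0 := by
    have hsum := sum_mul_apply_smul Q.transpose A.charmatrix.transpose b i₀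
    rw [← Matrix.transpose_mul] at hsum
    simpa only [Matrix.transpose_apply, A, sum_charmatrix_smul, smul_zero,
      Finset.sum_const_zero] using hsum
  have hrem : ∑ i, W i i₀ • b i = 0 := by
    rw [← hP j]
    simp only [hcol, add_smul, Finset.sum_add_distrib, hrel, zero_add]
    exact Finset.sum_congr rfl fun i _ => (algebraMap_smul S[X] _ (b i)).symm
  have hW : ∀ i, W i i₀ = 0 := Fintype.linearIndependent_iff.mp b.linearIndependent _ hrem
  refine ⟨fun i => Q i i₀, funext fun i => ?_⟩
  rw [hcol, hW, C_0, add_zero]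
  rfl

/- If `α` expresses the generators through the basis and `β` the basis through the generators, then
`N` being the characteristic matrix, `α D = N Q₁` and `1 - α β = N Q₂`, as the columns of both left
hand sides are relations between the elements of the basis. -/
theorem charpoly_dvd_det [Fintype κ] [DecidableEq κ] (b : Module.Basis ι S M) (v : κ → M)
    (hv : Submodule.span S[X] (Set.range v) = ⊤) (D : Matrix κ κ S[X])
    (hD : ∀ j, ∑ l, D j l • v l = 0) :
    (LinearMap.toMatrix b b (Algebra.lsmul S S M (X : S[X]))).charpoly ∣ D.det := by
  choose β hβ using fun i => Submodule.mem_span_range_iff_exists_fun S[X] |>.mp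
    (hv ▸ Submodule.mem_top : b i ∈ Submodule.span S[X] (Set.range v))
  let α : Matrix κ ι S[X] := Matrix.of fun l i => C (b.repr (v l) i)
  have hα : ∀ l, ∑ i, α l i • b i = v l := fun l => by
    conv_rhs => rw [← b.sum_repr (v l)]
    exact Finset.sum_congr rfl fun i _ => algebraMap_smul S[X] (b.repr (v l) i) (b i)
  obtain ⟨Q₁, hQ₁⟩ := exists_charmatrix_mul_eq b (D * α).transpose fun j => by
    simp only [Matrix.transpose_apply, sum_mul_apply_smul, hα, hD]
  obtain ⟨Q₂, hQ₂⟩ := exists_charmatrix_mul_eq b (1 - Matrix.of β * α).transpose fun i => by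
    simp only [Matrix.transpose_apply, Matrix.sub_apply, sub_smul, Finset.sum_sub_distrib,
      sum_mul_apply_smul, hα, Matrix.of_apply, hβ]
    simp [Matrix.one_apply]
  set N := (LinearMap.toMatrix b b (Algebra.lsmul S S M (X : S[X]))).charmatrix
  have hblocks : Matrix.fromBlocks 1 0 (-α.transpose) N *
      Matrix.fromBlocks D.transpose (-(Matrix.of β).transpose) Q₁ Q₂ =
      Matrix.fromBlocks D.transpose (-(Matrix.of β).transpose) 0 1 := by
    simp [Matrix.fromBlocks_multiply, hQ₁, hQ₂]
  have hdet := congrArg Matrix.det hblocks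
  rw [Matrix.det_mul, Matrix.det_fromBlocks_zero₁₂, Matrix.det_fromBlocks_zero₂₁, Matrix.det_one,
    Matrix.det_one, one_mul, mul_one, Matrix.det_transpose] at hdet
  exact Dvd.intro _ hdet

end LinearAlgebra

/-! ### Twisted cyclic matrices -/

section Twist

variable {B : Type*} [CommRing B]

/-- The `d × d` matrix of the cyclic shift whose `d`-th power is multiplication by `x`. -/
def shiftMatrix (d : ℕ) (x : B) : Matrix (Fin d) (Fin d) B :=
  Matrix.of fun j l => if (l : ℕ) = j + 1 then 1 else if (j : ℕ) + 1 = d ∧ (l : ℕ) = 0 then x else 0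

/-- The diagonal matrix with entries `a, a ^ q, a ^ (q ^ 2), …`. -/
def twistDiag (q d : ℕ) (a : B) : Matrix (Fin d) (Fin d) B :=
  Matrix.diagonal fun j => a ^ q ^ (j : ℕ)

/-- The matrix of right multiplication by `c₀ + c₁ τ + ⋯ + c_r τ ^ r` on skew polynomials in `τ`
in the basis `1, τ, …, τ ^ (d - 1)`, where `τ ^ d` acts as `x`. -/
def twistMatrix (q d r : ℕ) (c : ℕ → B) (x : B) : Matrix (Fin d) (Fin d) B :=
  ∑ i ∈ Finset.range (r + 1), twistDiag q d (c i) * shiftMatrix d x ^ i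

/-- The determinant of `T - twistMatrix q d r c x`. -/
def twistDet (q d r : ℕ) (c : ℕ → B) (T x : B) : B :=
  (Matrix.scalar (Fin d) T - twistMatrix q d r c x).det

variable {B' : Type*} [CommRing B'] (φ : B →+* B')

theorem map_shiftMatrix (d : ℕ) (x : B) :
    φ.mapMatrix (shiftMatrix d x) = shiftMatrix d (φ x) := by
  ext j l
  simp only [shiftMatrix, RingHom.mapMatrix_apply, Matrix.map_apply, Matrix.of_apply]
  split_ifs <;> simp

theorem map_twistDiag (q d : ℕ) (a : B) :
    φ.mapMatrix (twistDiag q d a) = twistDiag q d (φ a) := by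
  ext j l
  simp only [twistDiag, RingHom.mapMatrix_apply, Matrix.map_apply, Matrix.diagonal_apply]
  split_ifs <;> simp

theorem map_twistMatrix (q d r : ℕ) (c : ℕ → B) (x : B) :
    φ.mapMatrix (twistMatrix q d r c x) = twistMatrix q d r (fun i => φ (c i)) (φ x) := by
  simp only [twistMatrix, map_sum, map_mul, map_pow, map_shiftMatrix, map_twistDiag]

theorem charpoly_twistMatrix (q d r : ℕ) (c : ℕ → B) (x : B) :
    (twistMatrix q d r c x).charpoly = twistDet q d r (fun i => C (c i)) X (C x) := by
  rw [twistDet, Matrix.charpoly, Matrix.charmatrix, map_twistMatrix]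

theorem map_twistDet (q d r : ℕ) (c : ℕ → B) (T x : B) :
    φ (twistDet q d r c T x) = twistDet q d r (fun i => φ (c i)) (φ T) (φ x) := by
  rw [twistDet, RingHom.map_det, map_sub, map_twistMatrix, twistDet]
  congr 2
  ext j l
  by_cases h : j = l
  · subst h; simp
  · simp [h]

theorem twistMatrix_eq_of_le (q d : ℕ) {r r' : ℕ} (h : r ≤ r') (hq : 0 < q) (c : ℕ → B)
    (hc : ∀ i, r < i → c i = 0) (x : B) : twistMatrix q d r' c x = twistMatrix q d r c x := by
  symm
  refine Finset.sum_subset (Finset.range_mono (by omega)) fun i _ hi => ?_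
  rw [hc i (by simpa using hi)]
  have hdiag : twistDiag q d (0 : B) = 0 := by
    simp only [twistDiag, zero_pow (pow_pos hq _).ne', Matrix.diagonal_zero]
  rw [hdiag, zero_mul]

section Sequence

variable {H : Type*} [AddCommGroup H] [Module B H] {d : ℕ} {x : B} {v : ℕ → H}

theorem shiftMatrix_smul (hd : 0 < d) (hv : ∀ n, v (n + d) = x • v n) (j : Fin d) :
    ∑ l, shiftMatrix d x j l • v l = v (j + 1) := by
  by_cases hj : (j : ℕ) + 1 < d
  · rw [Finset.sum_eq_single ⟨j + 1, hj⟩]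
    · simp [shiftMatrix]
    · intro l _ hl
      have hlj : ¬ (l : ℕ) = j + 1 := fun e => hl (Fin.ext e)
      simp [shiftMatrix, hlj, hj.ne]
    · simp
  · have hjd : (j : ℕ) + 1 = d := by omega
    rw [Finset.sum_eq_single ⟨0, hd⟩]
    · simp [shiftMatrix, hjd, hd.ne, ← hv]
    · intro l _ hl
      have hl0 : ¬ (l : ℕ) = 0 := fun e => hl (Fin.ext e)
      simp [shiftMatrix, l.2.ne, hl0, hjd]
    · simp

theorem shiftMatrix_pow_smul (hd : 0 < d) (hv : ∀ n, v (n + d) = x • v n) (i : ℕ) (j : Fin d) :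
    ∑ l, (shiftMatrix d x ^ i) j l • v l = v (j + i) := by
  induction i generalizing v with
  | zero =>
    rw [Finset.sum_eq_single j] <;> simp +contextual [eq_comm]
  | succ i ih =>
    rw [pow_succ, sum_mul_apply_smul]
    simp only [shiftMatrix_smul hd hv]
    rw [ih (v := fun n => v (n + 1)) fun n => by rw [← hv, add_right_comm]]
    rfl

theorem twistMatrix_smul (hd : 0 < d) (hv : ∀ n, v (n + d) = x • v n) (q r : ℕ) (c : ℕ → B)
    (j : Fin d) :
    ∑ l, twistMatrix q d r c x j l • v l =
      ∑ i ∈ Finset.range (r + 1), c i ^ q ^ (j : ℕ) • v (j + i) := by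
  simp only [twistMatrix, Matrix.sum_apply, Finset.sum_smul]
  rw [Finset.sum_comm]
  refine Finset.sum_congr rfl fun i _ => ?_
  rw [sum_mul_apply_smul, Finset.sum_eq_single j]
  · rw [shiftMatrix_pow_smul hd hv]
    simp [twistDiag]
  · intro l _ hl
    simp [twistDiag, hl.symm]
  · simp

end Sequence

theorem shiftMatrix_pow_self {d : ℕ} (hd : 0 < d) (x : B) :
    shiftMatrix d x ^ d = Matrix.scalar (Fin d) x := by
  ext j m
  have hbasis := shiftMatrix_pow_smul (x := x) (H := B) hd
    (v := fun n => x ^ (n / d) * if n % d = m then 1 else 0)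
    (fun n => by simp [Nat.add_div_right _ hd, pow_succ']) d j
  simp only [Nat.add_div_right _ hd, Nat.add_mod_right, Nat.div_eq_of_lt (Fin.is_lt _),
    Nat.mod_eq_of_lt (Fin.is_lt _), pow_zero, smul_eq_mul, mul_ite, mul_one, mul_zero,
    zero_add, pow_one] at hbasis
  rw [Finset.sum_eq_single m] at hbasis
  · simpa [Matrix.diagonal_apply, Fin.ext_iff] using hbasis
  · intro l _ hl
    rw [if_neg (fun e => hl (Fin.ext e))]
  · simp

theorem det_shiftMatrix_ne_zero [IsDomain B] {d : ℕ} (hd : 0 < d) {x : B} (hx : x ≠ 0) :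
    (shiftMatrix d x).det ≠ 0 := by
  have hdet := congrArg Matrix.det (shiftMatrix_pow_self hd x)
  rw [Matrix.det_pow, Matrix.scalar_apply, Matrix.det_diagonal] at hdet
  intro h0
  rw [h0, zero_pow hd.ne'] at hdet
  exact Finset.prod_ne_zero_iff.mpr (fun _ _ => hx) hdet.symm

theorem shiftMatrix_mul_twistDiag {q d : ℕ} {a : B} (ha : a ^ q ^ d = a) (x : B) :
    shiftMatrix d x * twistDiag q d a = twistDiag q d (a ^ q) * shiftMatrix d x := by
  ext j l
  simp only [twistDiag, Matrix.mul_diagonal, Matrix.diagonal_mul, shiftMatrix, Matrix.of_apply]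
  rw [← pow_mul, ← pow_succ', mul_comm]
  split_ifs with hnext hlast
  · rw [hnext]
  · rw [hlast.1, hlast.2, ha]; simp
  · simp

theorem twistDet_frobenius [IsDomain B] {q d : ℕ} (hd : 0 < d) (r : ℕ) {c : ℕ → B}
    (hc : ∀ i, c i ^ q ^ d = c i) (T : B) {x : B} (hx : x ≠ 0) :
    twistDet q d r (fun i => c i ^ q) T x = twistDet q d r c T x := by
  symm
  refine det_eq_of_mul_eq (det_shiftMatrix_ne_zero hd hx) ?_
  rw [mul_sub, sub_mul, twistMatrix, twistMatrix, Finset.mul_sum, Finset.sum_mul]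
  congr 1
  · exact ((Matrix.scalar_commute T (fun _ => Commute.all _ _) _).eq).symm
  · refine Finset.sum_congr rfl fun i _ => ?_
    rw [← mul_assoc, shiftMatrix_mul_twistDiag (hc i), mul_assoc, mul_assoc, ← pow_succ,
      ← pow_succ']

theorem shiftMatrix_mul_diagonal_pow (d : ℕ) (y : B) :
    shiftMatrix d (y ^ d) * Matrix.diagonal (fun j : Fin d => y ^ (j : ℕ)) =
      Matrix.diagonal (fun j : Fin d => y ^ (j : ℕ)) * (y • shiftMatrix d (1 : B)) := by
  ext j l
  simp only [Matrix.mul_diagonal, Matrix.diagonal_mul, shiftMatrix, Matrix.of_apply,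
    Matrix.smul_apply, smul_eq_mul]
  split_ifs with hnext hlast
  · rw [hnext]
    ring
  · have hyd : y ^ d = y ^ (j : ℕ) * y := by rw [← pow_succ, hlast.1]
    rw [hlast.2, hyd]
    ring
  · simp

theorem shiftMatrix_pow_mul_diagonal_pow (d : ℕ) (y : B) (i : ℕ) :
    shiftMatrix d (y ^ d) ^ i * Matrix.diagonal (fun j : Fin d => y ^ (j : ℕ)) =
      Matrix.diagonal (fun j : Fin d => y ^ (j : ℕ)) * (y ^ i • shiftMatrix d (1 : B) ^ i) := by
  rw [← _root_.smul_pow]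
  exact (SemiconjBy.pow_right (shiftMatrix_mul_diagonal_pow d y).symm i).symm

theorem twistDet_pow_eq_det [IsDomain B] (q d r : ℕ) (c : ℕ → B) (T : B) {y : B} (hy : y ≠ 0) :
    twistDet q d r c T (y ^ d) = (Matrix.scalar (Fin d) T - ∑ i ∈ Finset.range (r + 1),
      y ^ i • (twistDiag q d (c i) * shiftMatrix d (1 : B) ^ i)).det := by
  symm
  refine det_eq_of_mul_eq (W := Matrix.diagonal (fun j : Fin d => y ^ (j : ℕ))) ?_ ?_
  · rw [Matrix.det_diagonal]
    exact Finset.prod_ne_zero_iff.mpr fun _ _ => pow_ne_zero _ hy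
  · rw [mul_sub, sub_mul, twistMatrix, Finset.mul_sum, Finset.sum_mul]
    congr 1
    · exact ((Matrix.scalar_commute T (fun _ => Commute.all _ _) _).eq).symm
    · refine Finset.sum_congr rfl fun i _ => ?_
      rw [mul_assoc, shiftMatrix_pow_mul_diagonal_pow, ← mul_assoc, mul_smul_comm, mul_smul_comm,
        ← mul_assoc, twistDiag, Matrix.diagonal_mul_diagonal, Matrix.diagonal_mul_diagonal]
      simp only [mul_comm]

end Twist

/-! ### The determinant `det (T - φ_θ)` as a polynomial in `x = τ ^ d` -/

section Generic

variable {K : Type*} [Field K]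

/-- The polynomials in `K[T][y]` all of whose monomials have weight at most `m`, where `T` has
weight `r` and `y` has weight `1`. -/
def weightLE (K : Type*) [Field K] (r m : ℕ) : AddSubgroup K[X][X] where
  carrier := {p | ∀ i j, m < r * j + i → (p.coeff i).coeff j = 0}
  add_mem' hp hp' i j hm := by rw [coeff_add, coeff_add, hp i j hm, hp' i j hm, add_zero]
  zero_mem' i j _ := by rw [coeff_zero, coeff_zero]
  neg_mem' hp i j hm := by rw [coeff_neg, coeff_neg, hp i j hm, neg_zero]

theorem one_mem_weightLE (r : ℕ) : (1 : K[X][X]) ∈ weightLE K r 0 := by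
  intro i j hm
  rw [coeff_one]
  split_ifs with hi
  · rw [coeff_one, if_neg]
    rintro rfl
    simp [hi] at hm
  · exact coeff_zero j

theorem mul_mem_weightLE {r m m' : ℕ} {p p' : K[X][X]} (hp : p ∈ weightLE K r m)
    (hp' : p' ∈ weightLE K r m') : p * p' ∈ weightLE K r (m + m') := by
  intro i j hm
  rw [coeff_mul, finsetSum_coeff]
  refine Finset.sum_eq_zero fun a ha => ?_
  rw [coeff_mul]
  refine Finset.sum_eq_zero fun e he => ?_
  rw [← Finset.HasAntidiagonal.mem_antidiagonal.mp ha,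
    ← Finset.HasAntidiagonal.mem_antidiagonal.mp he, mul_add] at hm
  by_cases h : m < r * e.1 + a.1
  · rw [hp _ _ h, zero_mul]
  · rw [hp' _ _ (by omega), mul_zero]

theorem prod_mem_weightLE {ι : Type*} {r m : ℕ} (s : Finset ι) {p : ι → K[X][X]}
    (hp : ∀ i ∈ s, p i ∈ weightLE K r m) : ∏ i ∈ s, p i ∈ weightLE K r (s.card * m) := by
  classical
  induction s using Finset.induction_on with
  | empty => simpa using one_mem_weightLE r
  | insert i s hi ih =>
    rw [Finset.prod_insert hi, Finset.card_insert_of_notMem hi, add_mul, one_mul, add_comm]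
    exact mul_mem_weightLE (hp i (Finset.mem_insert_self i s))
      (ih fun j hj => hp j (Finset.mem_insert_of_mem hj))

theorem det_mem_weightLE {n : Type*} [Fintype n] [DecidableEq n] {r m : ℕ}
    {M : Matrix n n K[X][X]} (hM : ∀ i j, M i j ∈ weightLE K r m) :
    M.det ∈ weightLE K r (Fintype.card n * m) := by
  rw [Matrix.det_apply]
  refine sum_mem fun σ _ => ?_
  rw [Units.smul_def]
  exact zsmul_mem (prod_mem_weightLE _ fun i _ => hM (σ i) i) _

/-- The determinant of `T - twistMatrix q d r c x` as a polynomial in `x` over `K[T]`. -/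
def twistPoly (q d r : ℕ) (c : ℕ → K) : K[X][X] :=
  twistDet q d r (fun i => C (C (c i))) (C X) X

/-- The matrix over `K[T][y]` whose determinant is the value of `twistPoly` at `x = y ^ d`. -/
def twistRootMatrix (q d r : ℕ) (c : ℕ → K) : Matrix (Fin d) (Fin d) K[X][X] :=
  Matrix.scalar (Fin d) (C X) - ∑ i ∈ Finset.range (r + 1),
    (X : K[X][X]) ^ i •
      (C.comp C : K →+* K[X][X]).mapMatrix (twistDiag q d (c i) * shiftMatrix d (1 : K) ^ i)

theorem expand_twistPoly {d : ℕ} (q r : ℕ) (c : ℕ → K) :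
    expand K[X] d (twistPoly q d r c) = (twistRootMatrix q d r c).det := by
  change (expand K[X] d : K[X][X] →+* K[X][X]) _ = _
  rw [twistPoly, map_twistDet, twistRootMatrix]
  simp only [RingHom.coe_coe, expand_C, expand_X]
  rw [twistDet_pow_eq_det _ _ _ _ _ X_ne_zero]
  simp only [map_mul, map_pow, map_twistDiag, map_shiftMatrix, map_one, RingHom.comp_apply]

theorem twistRootMatrix_apply (q d r : ℕ) (c : ℕ → K) (j l : Fin d) :
    twistRootMatrix q d r c j l = C (if j = l then X else 0) -
      ∑ i ∈ Finset.range (r + 1),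
        C (C ((twistDiag q d (c i) * shiftMatrix d (1 : K) ^ i) j l)) * X ^ i := by
  simp only [twistRootMatrix, Matrix.sub_apply, Matrix.sum_apply, Matrix.smul_apply,
    RingHom.mapMatrix_apply, Matrix.map_apply, smul_eq_mul, RingHom.comp_apply,
    Matrix.scalar_apply, Matrix.diagonal_apply]
  congr 1
  · split_ifs <;> simp
  · exact Finset.sum_congr rfl fun i _ => mul_comm _ _

theorem coeff_twistRootMatrix (q d r : ℕ) (c : ℕ → K) (j l : Fin d) (n : ℕ) :
    (twistRootMatrix q d r c j l).coeff n = (if n = 0 then (if j = l then X else 0) else 0) -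
      if n < r + 1 then C ((twistDiag q d (c n) * shiftMatrix d (1 : K) ^ n) j l) else 0 := by
  rw [twistRootMatrix_apply]
  simp only [coeff_sub, coeff_C, finsetSum_coeff, coeff_C_mul, coeff_X_pow, mul_ite, mul_one,
    mul_zero, Finset.sum_ite_eq, Finset.mem_range]

theorem natDegree_twistRootMatrix_le (q d r : ℕ) (c : ℕ → K) (j l : Fin d) :
    (twistRootMatrix q d r c j l).natDegree ≤ r := by
  rw [natDegree_le_iff_coeff_eq_zero]
  intro n hn
  rw [coeff_twistRootMatrix, if_neg (by omega), if_neg (by omega), sub_zero]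

theorem coeff_twistPoly {d : ℕ} (hd : 0 < d) (q r : ℕ) (c : ℕ → K) (i : ℕ) :
    (twistPoly q d r c).coeff i = (twistRootMatrix q d r c).det.coeff (d * i) := by
  rw [← expand_twistPoly, mul_comm, coeff_expand_mul hd]

theorem natDegree_twistPoly_le {d : ℕ} (hd : 0 < d) (q r : ℕ) (c : ℕ → K) :
    (twistPoly q d r c).natDegree ≤ r := by
  have hdeg := natDegree_det_le _ r (natDegree_twistRootMatrix_le q d r c)
  rw [← expand_twistPoly, natDegree_expand, Fintype.card_fin, mul_comm] at hdeg
  exact le_of_mul_le_mul_left hdeg hd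

theorem coeff_twistPoly_rank {q d r : ℕ} (hd : 0 < d) (hr : 0 < r) {c : ℕ → K}
    (hc : c r ≠ 0) : ∃ a : K, a ≠ 0 ∧ (twistPoly q d r c).coeff r = C a := by
  have hcoeff := coeff_det_card_mul _ r (natDegree_twistRootMatrix_le q d r c)
  rw [Fintype.card_fin, ← coeff_twistPoly hd] at hcoeff
  have htop : (twistRootMatrix q d r c).map (fun p => p.coeff r) =
      (C : K →+* K[X]).mapMatrix (-(twistDiag q d (c r) * shiftMatrix d (1 : K) ^ r)) := by
    ext1 j l
    rw [Matrix.map_apply, coeff_twistRootMatrix, if_neg hr.ne', if_pos (by omega)]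
    simp
  rw [htop, ← RingHom.map_det] at hcoeff
  refine ⟨_, ?_, hcoeff⟩
  rw [Matrix.det_neg, Matrix.det_mul, Matrix.det_pow, twistDiag, Matrix.det_diagonal]
  refine mul_ne_zero (pow_ne_zero _ (by simp)) (mul_ne_zero ?_ (pow_ne_zero _ ?_))
  · exact Finset.prod_ne_zero_iff.mpr fun _ _ => pow_ne_zero _ hc
  · exact det_shiftMatrix_ne_zero hd one_ne_zero

theorem coeff_zero_twistPoly {d : ℕ} (hd : 0 < d) (q r : ℕ) (c : ℕ → K) :
    (twistPoly q d r c).coeff 0 = ∏ j : Fin d, (X - C (c 0 ^ q ^ (j : ℕ))) := by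
  rw [coeff_twistPoly hd, mul_zero, ← constantCoeff_apply, RingHom.map_det,
    ← Matrix.det_diagonal]
  congr 1
  ext1 j l
  rw [RingHom.mapMatrix_apply, Matrix.map_apply, constantCoeff_apply, coeff_twistRootMatrix]
  by_cases hjl : j = l
  · subst hjl
    simp [twistDiag]
  · simp [hjl, twistDiag]

theorem twistRootMatrix_apply_mem_weightLE (q d r : ℕ) (c : ℕ → K) (j l : Fin d) :
    twistRootMatrix q d r c j l ∈ weightLE K r r := by
  rw [twistRootMatrix_apply]
  refine sub_mem ?_ (sum_mem fun i hi n m hlt => ?_)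
  · split_ifs
    · intro n m hlt
      rw [coeff_C]
      split_ifs with hn
      · rw [coeff_X, if_neg]
        rintro rfl
        omega
      · exact coeff_zero m
    · rw [C_0]
      exact zero_mem _
  · rw [coeff_C_mul_X_pow]
    split_ifs with hn
    · rw [coeff_C, if_neg]
      rintro rfl
      rw [Finset.mem_range] at hi
      omega
    · exact coeff_zero m

theorem weight_coeff_twistPoly_le {d : ℕ} (hd : 0 < d) (q r : ℕ) (c : ℕ → K) {i : ℕ}
    (hi : (twistPoly q d r c).coeff i ≠ 0) :
    r * ((twistPoly q d r c).coeff i).natDegree + d * i ≤ r * d := by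
  have hdet := det_mem_weightLE (twistRootMatrix_apply_mem_weightLE q d r c)
  rw [Fintype.card_fin, mul_comm] at hdet
  by_contra! hlt
  refine hi (leadingCoeff_eq_zero.mp ?_)
  rw [leadingCoeff, coeff_twistPoly hd]
  exact hdet _ _ (by rwa [← coeff_twistPoly hd])

end Generic

section Descent

variable {F K : Type*} [Field F] [Fintype F] [Field K] [Algebra F K]

theorem mem_range_algebraMap_of_pow_card {a : K} (ha : a ^ Fintype.card F = a) :
    a ∈ (algebraMap F K).range := by
  have hq : 1 < Fintype.card F := Fintype.one_lt_card
  have hsplits : (X ^ Fintype.card F - X : F[X]).Splits := by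
    rw [splits_iff_card_roots, FiniteField.roots_X_pow_card_sub_X,
      FiniteField.X_pow_card_sub_X_natDegree_eq _ hq]
    rfl
  exact hsplits.mem_range_of_isRoot (FiniteField.X_pow_card_sub_X_ne_zero _ hq) (by simp [ha])

theorem exists_map_eq_twistPoly {d : ℕ} (hd : 0 < d)
    (hK : ∀ a : K, a ^ Fintype.card F ^ d = a) (r : ℕ) (c : ℕ → K) :
    ∃ Q : F[X][X], Q.map (mapRingHom (algebraMap F K)) = twistPoly (Fintype.card F) d r c := by
  have hfix : (twistPoly (Fintype.card F) d r c).map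
      (mapRingHom (FiniteField.frobeniusAlgHom F K : K →+* K)) =
      twistPoly (Fintype.card F) d r c := by
    rw [← coe_mapRingHom, twistPoly, map_twistDet]
    simp only [coe_mapRingHom, map_C, map_X, RingHom.coe_coe, FiniteField.coe_frobeniusAlgHom,
      C_pow]
    exact twistDet_frobenius hd r (fun i => by rw [← C_pow, ← C_pow, hK]) _ X_ne_zero
  refine (mem_map_range (mapRingHom (algebraMap F K))).mpr fun i =>
    (mem_map_range (algebraMap F K)).mpr fun j => mem_range_algebraMap_of_pow_card ?_
  conv_rhs => rw [← hfix]
  rw [coeff_map, coe_mapRingHom, coeff_map]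
  rfl

end Descent

/-! ### Powers of the Frobenius -/

section Frobenius

variable {F R : Type*} [Field F] [Fintype F] [CommRing R] [Algebra F R]

theorem frobeniusAlgHom_pow_apply (m : ℕ) (x : R) :
    (FiniteField.frobeniusAlgHom F R ^ m) x = x ^ Fintype.card F ^ m := by
  rw [AlgHom.coe_pow, FiniteField.coe_frobeniusAlgHom, pow_iterate]

theorem aeval_pow_card_pow (p : F[X]) (x : R) (m : ℕ) :
    aeval (x ^ Fintype.card F ^ m) p = aeval x p ^ Fintype.card F ^ m := by
  rw [← frobeniusAlgHom_pow_apply, aeval_algHom_apply, frobeniusAlgHom_pow_apply]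

variable (F) in
/-- The action of `c₀ + c₁ τ + ⋯ + c_r τ ^ r` on `R`, where `τ(x) = x ^ q`. -/
abbrev frobSkewOp (r : ℕ) (c : ℕ → R) : Module.End F R :=
  skewOp (FiniteField.frobeniusAlgHom F R) r c

theorem frobSkewOp_apply (r : ℕ) (c : ℕ → R) (x : R) :
    frobSkewOp F r c x = ∑ i ∈ Finset.range (r + 1), c i * x ^ Fintype.card F ^ i := by
  simp only [skewOp, LinearMap.sum_apply, Module.End.mul_apply, LinearMap.mulLeft_apply,
    Module.End.pow_apply, AlgHom.coe_toLinearMap, FiniteField.coe_frobeniusAlgHom, pow_iterate]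

theorem frobSkewOp_pow_apply_pow {d : ℕ} (r : ℕ) {c : ℕ → R}
    (hc : ∀ i, c i ^ Fintype.card F ^ d = c i) (i : ℕ) (x : R) :
    (frobSkewOp F r c ^ i) x ^ Fintype.card F ^ d =
      (frobSkewOp F r c ^ i) (x ^ Fintype.card F ^ d) := by
  induction i with
  | zero => simp
  | succ i ih =>
    rw [pow_succ', Module.End.mul_apply, Module.End.mul_apply, ← ih, frobSkewOp_apply,
      frobSkewOp_apply, ← frobeniusAlgHom_pow_apply d, map_sum]
    refine Finset.sum_congr rfl fun m _ => ?_
    rw [map_mul, frobeniusAlgHom_pow_apply, frobeniusAlgHom_pow_apply, hc, pow_right_comm]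

end Frobenius

/-! ### The determinant `det (T - φ_θ)` modulo `f` -/

section Local

variable {F : Type*} [Field F] (φ : DrinfeldModule F) (f : MonicIrred F)

theorem natDegree_pos : 0 < f.1.natDegree := f.2.2.natDegree_pos

theorem finrank_adjoinRoot : Module.finrank F (AdjoinRoot f.1) = f.1.natDegree :=
  finrank_quotient_span_eq_natDegree

theorem map_adjoinRoot_injective :
    Function.Injective (Polynomial.map (algebraMap F (AdjoinRoot f.1))) :=
  map_injective _ (algebraMap F (AdjoinRoot f.1)).injective

/-- The coefficients of the reduction of `φ_θ` modulo `f`. -/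
def redCoeff (i : ℕ) : AdjoinRoot f.1 := AdjoinRoot.mk f.1 (φ.coeff i)

open Classical in
/-- The rank `r₀` of the reduction of `φ` modulo `f`. -/
def redRank : ℕ := Nat.findGreatest (fun i => redCoeff φ f i ≠ 0) φ.rank

theorem redRank_le : redRank φ f ≤ φ.rank := Nat.findGreatest_le _

theorem redCoeff_redRank (h : 0 < redRank φ f) : redCoeff φ f (redRank φ f) ≠ 0 :=
  Nat.findGreatest_of_ne_zero (P := fun i => redCoeff φ f i ≠ 0) rfl h.ne'

theorem redCoeff_of_gt {i : ℕ} (h : redRank φ f < i) : redCoeff φ f i = 0 := by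
  by_cases hi : i ≤ φ.rank
  · by_contra h0
    exact Nat.findGreatest_is_greatest (P := fun i => redCoeff φ f i ≠ 0) h hi h0
  · rw [redCoeff, φ.coeff_of_gt i (by omega), map_zero]

theorem redCoeff_zero : redCoeff φ f 0 = AdjoinRoot.root f.1 := by
  rw [redCoeff, φ.coeff_zero, AdjoinRoot.mk_X]

variable [Fintype F]

theorem root_pow_card_pow_injective :
    Function.Injective fun j : Fin f.1.natDegree =>
      AdjoinRoot.root f.1 ^ Fintype.card F ^ (j : ℕ) := by
  have : Module.Finite F (AdjoinRoot f.1) := f.2.1.finite_adjoinRoot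
  have hfin : Finite (AdjoinRoot f.1) := Module.finite_of_finite F
  intro i j hij
  have heq := (FiniteField.bijective_frobeniusAlgHom_pow F (AdjoinRoot f.1)).1
    (a₁ := ⟨i, by rw [finrank_adjoinRoot]; exact i.2⟩)
    (a₂ := ⟨j, by rw [finrank_adjoinRoot]; exact j.2⟩) (by
      refine AdjoinRoot.algHom_ext ?_
      simpa only [frobeniusAlgHom_pow_apply] using hij)
  exact Fin.ext (by simpa using heq)

theorem prod_X_sub_C_root_pow :
    ∏ j : Fin f.1.natDegree, (X - C (AdjoinRoot.root f.1 ^ Fintype.card F ^ (j : ℕ))) =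
      f.1.map (algebraMap F (AdjoinRoot f.1)) := by
  symm
  refine eq_of_monic_of_dvd_of_natDegree_le (monic_prod_X_sub_C _ _) (f.2.1.map _) ?_ ?_
  · refine Finset.prod_dvd_of_coprime (fun i _ j _ hij => ?_) fun j _ => ?_
    · exact pairwise_coprime_X_sub_C (root_pow_card_pow_injective f) hij
    · rw [dvd_iff_isRoot, IsRoot, eval_map_algebraMap, aeval_pow_card_pow, AdjoinRoot.aeval_eq,
        AdjoinRoot.mk_self, zero_pow (pow_pos Fintype.card_pos _).ne']
  · rw [natDegree_map, natDegree_prod_of_monic _ _ fun _ _ => monic_X_sub_C _]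
    simp only [natDegree_X_sub_C, Finset.sum_const, Finset.card_univ, Fintype.card_fin, smul_eq_mul,
      mul_one, le_refl]

theorem exists_localPoly : ∃ Q : F[X][X], Q.map (mapRingHom (algebraMap F (AdjoinRoot f.1))) =
    twistPoly (Fintype.card F) f.1.natDegree φ.rank (redCoeff φ f) :=
  exists_map_eq_twistPoly (natDegree_pos f) (pow_card_pow f) _ _

/-- The determinant of `T - φ_θ` modulo `f` as a polynomial in `x = τ ^ d` over `𝔽_q[T]`. -/
def localPoly : F[X][X] := (exists_localPoly φ f).choose

theorem map_localPoly : (localPoly φ f).map (mapRingHom (algebraMap F (AdjoinRoot f.1))) =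
    twistPoly (Fintype.card F) f.1.natDegree φ.rank (redCoeff φ f) :=
  (exists_localPoly φ f).choose_spec

theorem map_localPoly_redRank :
    (localPoly φ f).map (mapRingHom (algebraMap F (AdjoinRoot f.1))) =
      twistPoly (Fintype.card F) f.1.natDegree (redRank φ f) (redCoeff φ f) := by
  rw [map_localPoly, twistPoly, twistPoly, twistDet, twistDet,
    twistMatrix_eq_of_le _ _ (redRank_le φ f) Fintype.card_pos]
  intro i hi
  rw [redCoeff_of_gt φ f hi, C_0, C_0]

theorem map_coeff_localPoly (i : ℕ) :
    ((localPoly φ f).coeff i).map (algebraMap F (AdjoinRoot f.1)) =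
      (twistPoly (Fintype.card F) f.1.natDegree φ.rank (redCoeff φ f)).coeff i := by
  rw [← map_localPoly, coeff_map, coe_mapRingHom]

theorem map_coeff_localPoly_redRank (i : ℕ) :
    ((localPoly φ f).coeff i).map (algebraMap F (AdjoinRoot f.1)) =
      (twistPoly (Fintype.card F) f.1.natDegree (redRank φ f) (redCoeff φ f)).coeff i := by
  rw [← map_localPoly_redRank, coeff_map, coe_mapRingHom]

theorem localPoly_coeff_zero : (localPoly φ f).coeff 0 = f.1 := by
  apply map_adjoinRoot_injective f
  rw [map_coeff_localPoly, coeff_zero_twistPoly (natDegree_pos f), redCoeff_zero,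
    prod_X_sub_C_root_pow]

theorem weight_coeff_localPoly_le {i : ℕ} (hi : (localPoly φ f).coeff i ≠ 0) :
    φ.rank * ((localPoly φ f).coeff i).natDegree + f.1.natDegree * i ≤
      φ.rank * f.1.natDegree := by
  have hweight := weight_coeff_twistPoly_le (natDegree_pos f) (Fintype.card F) φ.rank
    (redCoeff φ f) (i := i) (by
      rwa [← map_coeff_localPoly, Ne, Polynomial.map_eq_zero])
  rwa [← map_coeff_localPoly, natDegree_map] at hweight

theorem natDegree_localPoly_le : (localPoly φ f).natDegree ≤ redRank φ f := by
  have hle := natDegree_twistPoly_le (natDegree_pos f) (Fintype.card F) (redRank φ f)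
    (redCoeff φ f)
  rwa [← map_localPoly_redRank, natDegree_map_eq_of_injective] at hle
  exact map_adjoinRoot_injective f

theorem coeff_localPoly_redRank (h : 0 < redRank φ f) :
    ∃ a : F, a ≠ 0 ∧ (localPoly φ f).coeff (redRank φ f) = C a := by
  obtain ⟨b, hb, e⟩ := coeff_twistPoly_rank (q := Fintype.card F) (natDegree_pos f) h
    (redCoeff_redRank φ f h)
  rw [← map_coeff_localPoly_redRank] at e
  have hdeg : ((localPoly φ f).coeff (redRank φ f)).natDegree = 0 := by
    rw [← natDegree_map (algebraMap F (AdjoinRoot f.1)), e, natDegree_C]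
  obtain ⟨a, ha⟩ := natDegree_eq_zero.mp hdeg
  refine ⟨a, ?_, ha.symm⟩
  rintro rfl
  rw [← ha, C_0, Polynomial.map_zero] at e
  exact hb (C_eq_zero.mp e.symm)

theorem natDegree_localPoly : (localPoly φ f).natDegree = redRank φ f := by
  refine (natDegree_localPoly_le φ f).antisymm ?_
  rcases Nat.eq_zero_or_pos (redRank φ f) with h | h
  · omega
  · obtain ⟨a, ha, e⟩ := coeff_localPoly_redRank φ f h
    exact le_natDegree_of_ne_zero (by rw [e]; exact C_ne_zero.mpr ha)

end Local

/-! ### Freeness of Tate modules -/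

section TateFree

variable {R N : Type*} [CommRing R] [AddCommGroup N] [Module R N] {h : R}

theorem tateModule_pow_smul_apply (x : tateModule N h) (m k : ℕ) : h ^ m • x.1 (k + m) = x.1 k := by
  induction m with
  | zero => simp
  | succ m ih => rw [pow_succ, mul_smul, ← add_assoc, x.2.2, ih]

theorem exists_tateModule_apply_one (hdiv : ∀ x : N, ∃ y, h • y = x) {x : N} (hx : h • x = 0) :
    ∃ y : tateModule N h, y.1 1 = x := by
  choose s hs using hdiv
  refine ⟨⟨fun k => Nat.rec 0 (fun k _ => s^[k] x) k, rfl, fun k => ?_⟩, rfl⟩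
  cases k with
  | zero => exact hx
  | succ k =>
    change h • s^[k + 1] x = s^[k] x
    rw [Function.iterate_succ_apply', hs]

theorem mem_span_pow_smul_top {k : ℕ} {a : R} :
    a ∈ (Ideal.span {h} ^ k • ⊤ : Ideal R) ↔ h ^ k ∣ a := by
  rw [smul_eq_mul, Ideal.mul_top, Ideal.span_singleton_pow, Ideal.mem_span_singleton]

variable {ι : Type*} [Fintype ι]

/-- The family `e` is a basis of the `h`-torsion `N[h]` over `R / h R`. This is expressed through
the coefficients in `R`, so that it can be used for all the powers of `h` at once. -/
structure IsTorsionBasis (h : R) (e : ι → N) : Prop where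
  smul_eq_zero : ∀ l, h • e l = 0
  exists_sum_smul_eq : ∀ x : N, h • x = 0 → ∃ a : ι → R, ∑ l, a l • e l = x
  dvd_of_sum_smul_eq_zero : ∀ a : ι → R, ∑ l, a l • e l = 0 → ∀ l, h ∣ a l

theorem IsTorsionBasis.of_basis
    (b : Module.Basis ι (R ⧸ Ideal.span {h}) (Submodule.torsionBy R N h)) :
    IsTorsionBasis h fun l => (b l : N) where
  smul_eq_zero l := (b l).2
  exists_sum_smul_eq x hx := by
    choose a ha using fun l => Ideal.Quotient.mk_surjective (b.repr ⟨x, hx⟩ l)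
    have hsum := b.sum_repr ⟨x, hx⟩
    simp only [← ha] at hsum
    exact ⟨a, by simpa using congrArg (Submodule.subtype _) hsum⟩
  dvd_of_sum_smul_eq_zero a ha l := by
    have hsum : ∑ l, Ideal.Quotient.mk (Ideal.span {h}) (a l) • b l = 0 :=
      Subtype.ext (by simpa using ha)
    have hl := Fintype.linearIndependent_iff.mp b.linearIndependent _ hsum l
    rwa [Ideal.Quotient.eq_zero_iff_mem, Ideal.mem_span_singleton] at hl

variable {e : ι → tateModule N h}

theorem IsTorsionBasis.exists_sum_smul_level (he : IsTorsionBasis h fun l => (e l).1 1) (k : ℕ)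
    {x : N} (hx : h ^ k • x = 0) : ∃ a : ι → R, ∑ l, a l • (e l).1 k = x := by
  induction k generalizing x with
  | zero => exact ⟨0, by simpa using hx.symm⟩
  | succ k ih =>
    obtain ⟨a, ha⟩ := he.exists_sum_smul_eq (h ^ k • x) (by rw [← mul_smul, ← pow_succ', hx])
    obtain ⟨b, hb⟩ := ih (x := x - ∑ l, a l • (e l).1 (k + 1)) (by
      rw [smul_sub, Finset.smul_sum, sub_eq_zero, ← ha]
      refine Finset.sum_congr rfl fun l _ => ?_
      rw [smul_comm, add_comm k 1, tateModule_pow_smul_apply])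
    refine ⟨fun l => a l + h * b l, ?_⟩
    simp only [add_smul, Finset.sum_add_distrib, mul_comm h, mul_smul, (e _).2.2, hb]
    abel

theorem IsTorsionBasis.pow_dvd_of_sum_smul_level (he : IsTorsionBasis h fun l => (e l).1 1)
    (k : ℕ) {a : ι → R} (ha : ∑ l, a l • (e l).1 k = 0) (l : ι) : h ^ k ∣ a l := by
  induction k generalizing a with
  | zero => simp
  | succ k ih =>
    have hdvd : ∀ l, h ∣ a l := he.dvd_of_sum_smul_eq_zero a (by
      have hsum := congrArg (fun y => h ^ k • y) ha
      simpa only [Finset.smul_sum, smul_zero, smul_comm (h ^ k), add_comm k 1,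
        tateModule_pow_smul_apply] using hsum)
    choose b hb using hdvd
    rw [hb l, pow_succ']
    refine mul_dvd_mul_left _ (ih ?_)
    rw [← ha]
    refine Finset.sum_congr rfl fun l _ => ?_
    rw [hb l, mul_comm, mul_smul, (e l).2.2]

theorem IsTorsionBasis.level (he : IsTorsionBasis h fun l => (e l).1 1) (k : ℕ) :
    IsTorsionBasis (h ^ k) fun l => (e l).1 k where
  smul_eq_zero l := tateModule_pow_smul (e l) k
  exists_sum_smul_eq _ hx := he.exists_sum_smul_level k hx
  dvd_of_sum_smul_eq_zero _ ha := he.pow_dvd_of_sum_smul_level k ha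

theorem adic_sum_smul_apply (α : ι → AdicCompletion (Ideal.span {h}) R) (k : ℕ) {a : ι → R}
    (ha : ∀ l, Ideal.Quotient.mk _ (a l) = (α l).1 k) :
    (∑ l, α l • e l).1 k = ∑ l, a l • (e l).1 k := by
  rw [AddSubmonoidClass.coe_finsetSum, Finset.sum_apply]
  exact Finset.sum_congr rfl fun l _ => adic_smul_apply_of_mk (ha l) _

theorem IsTorsionBasis.linearIndependent (he : IsTorsionBasis h fun l => (e l).1 1) :
    LinearIndependent (AdicCompletion (Ideal.span {h}) R) e := by
  rw [Fintype.linearIndependent_iff]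
  intro α hα l
  refine AdicCompletion.ext fun k => ?_
  choose a ha using fun l => Ideal.Quotient.mk_surjective ((α l).1 k)
  have hsum : ∑ l, a l • (e l).1 k = 0 := by
    rw [← adic_sum_smul_apply α k ha, hα]
    rfl
  rw [← ha l]
  exact Ideal.Quotient.eq_zero_iff_mem.mpr
    (mem_span_pow_smul_top.mpr (he.pow_dvd_of_sum_smul_level k hsum l))

theorem IsTorsionBasis.exists_sum_adic_smul_eq (he : IsTorsionBasis h fun l => (e l).1 1)
    (x : tateModule N h) :
    ∃ α : ι → AdicCompletion (Ideal.span {h}) R, ∑ l, α l • e l = x := by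
  choose a ha using fun k => he.exists_sum_smul_level k (tateModule_pow_smul x k)
  have hcompat : ∀ l {m n : ℕ}, m ≤ n → a n l - a m l ∈ (Ideal.span {h} ^ m • ⊤ : Ideal R) := by
    intro l m n hmn
    rw [mem_span_pow_smul_top]
    obtain ⟨i, rfl⟩ := Nat.exists_eq_add_of_le hmn
    refine he.pow_dvd_of_sum_smul_level (a := fun l => a (m + i) l - a m l) m ?_ l
    simp only [sub_smul, Finset.sum_sub_distrib]
    rw [ha, ← tateModule_pow_smul_apply x i, ← ha, Finset.smul_sum, sub_eq_zero]
    refine Finset.sum_congr rfl fun l _ => ?_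
    rw [smul_comm, tateModule_pow_smul_apply]
  let α : ι → AdicCompletion (Ideal.span {h}) R := fun l =>
    ⟨fun k => Ideal.Quotient.mk _ (a k l), fun {m n} hmn =>
      (Ideal.Quotient.mk_eq_mk_iff_sub_mem _ _).mpr (hcompat l hmn)⟩
  refine ⟨α, Subtype.ext (funext fun k => ?_)⟩
  exact (adic_sum_smul_apply α k (a := a k) fun l => rfl).trans (ha k)

theorem IsTorsionBasis.exists_basis (he : IsTorsionBasis h fun l => (e l).1 1) :
    ∃ b : Module.Basis ι (AdicCompletion (Ideal.span {h}) R) (tateModule N h), ∀ l, b l = e l := by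
  refine ⟨Module.Basis.mk he.linearIndependent fun x _ => ?_, fun l => by simp⟩
  exact (Submodule.mem_span_range_iff_exists_fun _).mpr (he.exists_sum_adic_smul_eq x)

variable [DecidableEq ι]

theorem exists_matrix_tateMap_level
    (b : Module.Basis ι (AdicCompletion (Ideal.span {h}) R) (tateModule N h)) (u : N →ₗ[R] N)
    (k : ℕ) :
    ∃ G : Matrix ι ι R, (∀ j, u ((b j).1 k) = ∑ i, G i j • (b i).1 k) ∧
      (LinearMap.toMatrix b b (tateMap h u)).map (AdicCompletion.evalₐ (Ideal.span {h}) k) =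
        G.map (Ideal.Quotient.mk (Ideal.span {h} ^ k)) := by
  choose G hG using fun i j => Ideal.Quotient.mk_surjective
    ((LinearMap.toMatrix b b (tateMap h u) i j).1 k)
  refine ⟨Matrix.of G, fun j => ?_, ?_⟩
  · have himage : tateMap h u (b j) = ∑ i, LinearMap.toMatrix b b (tateMap h u) i j • b i := by
      conv_lhs => rw [← b.sum_repr (tateMap h u (b j))]
      simp only [LinearMap.toMatrix_apply]
    exact (congrArg (fun y => y.1 k) himage).trans (adic_sum_smul_apply _ k fun i => hG i j)
  · ext1 i j
    rw [Matrix.map_apply, Matrix.map_apply, Matrix.of_apply,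
      ← AdicCompletion.factor_eval_eq_evalₐ _ _ (le_of_eq (Ideal.mul_top _)),
      AdicCompletion.eval_apply, ← hG i j]
    rfl

theorem exists_basis_charpoly_tateMap_eq (hdiv : ∀ x : N, ∃ y, h • y = x) {e₁ : ι → N}
    (he₁ : IsTorsionBasis h e₁) (u : N →ₗ[R] N) (P : R[X])
    (hlevel : ∀ (k : ℕ) (E : ι → N) (G : Matrix ι ι R), IsTorsionBasis (h ^ k) E →
      (∀ j, u (E j) = ∑ i, G i j • E i) → ∀ n, h ^ k ∣ (G.charpoly - P).coeff n) :
    ∃ b : Module.Basis ι (AdicCompletion (Ideal.span {h}) R) (tateModule N h),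
      (LinearMap.toMatrix b b (tateMap h u)).charpoly =
        P.map (algebraMap R (AdicCompletion (Ideal.span {h}) R)) := by
  choose e he using fun l => exists_tateModule_apply_one hdiv (he₁.smul_eq_zero l)
  obtain rfl : (fun l => (e l).1 1) = e₁ := funext he
  obtain ⟨b, hb⟩ := he₁.exists_basis
  obtain rfl : (fun l => b l) = e := funext hb
  refine ⟨b, ?_⟩
  ext1 n
  refine AdicCompletion.ext_evalₐ fun k => ?_
  obtain ⟨G, hu, hG⟩ := exists_matrix_tateMap_level b u k
  have hcharpoly : (LinearMap.toMatrix b b (tateMap h u)).charpoly.map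
      (AdicCompletion.evalₐ (Ideal.span {h}) k : _ →+* _) =
      G.charpoly.map (Ideal.Quotient.mk (Ideal.span {h} ^ k)) := by
    rw [← Matrix.charpoly_map, ← Matrix.charpoly_map]
    exact congrArg Matrix.charpoly hG
  have hcoeff := congrArg (fun p => p.coeff n) hcharpoly
  simp only [coeff_map, RingHom.coe_coe] at hcoeff
  rw [hcoeff, coeff_map, AlgHom.commutes]
  change _ = Ideal.Quotient.mk _ (P.coeff n)
  rw [Ideal.Quotient.mk_eq_mk_iff_sub_mem, ← coeff_sub, Ideal.span_singleton_pow,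
    Ideal.mem_span_singleton]
  exact hlevel k _ G (he₁.level k) hu n

end TateFree

/-! ### Torsion of skew polynomials in the Frobenius -/

theorem exists_basis_of_isField {R V : Type*} [CommRing R] (hR : IsField R) [AddCommGroup V]
    [Module R V] [Finite V] {n : ℕ} (hcard : 1 < Nat.card R) (hV : Nat.card V = Nat.card R ^ n) :
    Nonempty (Module.Basis (Fin n) R V) := by
  let _ : Field R := hR.toField
  have : Module.Finite R V := Module.Finite.of_finite
  refine ⟨Module.finBasisOfFinrankEq R V ?_⟩
  rw [Module.natCard_eq_pow_finrank (K := R)] at hV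
  exact Nat.pow_right_injective hcard hV

section IteratedComp

variable {k R : Type*} [CommRing k] [CommRing R] [Algebra k R]

/-- The polynomial `∑ g_n P ∘ ⋯ ∘ P` (`n`-fold composition), through which `g ∈ k[X]` acts on a
`k[X]`-module on which `X` acts as the map `x ↦ P(x)`. -/
def compSum (P : R[X]) (g : k[X]) : R[X] :=
  ∑ n ∈ Finset.range (g.natDegree + 1), C (algebraMap k R (g.coeff n)) * P.comp^[n] X

theorem eval_compSum {P : R[X]} {u : Module.End k R} (hP : ∀ x, P.eval x = u x) (g : k[X])
    (x : R) : (compSum P g).eval x = aeval u g x := by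
  rw [aeval_eq_sum_range, compSum, eval_finsetSum, LinearMap.sum_apply]
  refine Finset.sum_congr rfl fun n _ => ?_
  rw [eval_mul, eval_C, iterate_comp_eval, eval_X, LinearMap.smul_apply, Algebra.smul_def,
    Module.End.pow_apply]
  simp only [hP]

theorem derivative_iterate_comp {P : R[X]} {a : R} (hP : derivative P = C a) (n : ℕ) :
    derivative (P.comp^[n] X) = C (a ^ n) := by
  induction n with
  | zero => simp
  | succ n ih =>
    rw [Function.iterate_succ_apply', derivative_comp, hP, ih, C_comp, ← C_mul, pow_succ]

theorem derivative_compSum {P : R[X]} {a : R} (hP : derivative P = C a) (g : k[X]) :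
    derivative (compSum P g) = C (aeval a g) := by
  rw [compSum, derivative_sum, aeval_eq_sum_range, map_sum]
  refine Finset.sum_congr rfl fun n _ => ?_
  rw [derivative_C_mul, derivative_iterate_comp hP, ← C_mul, Algebra.smul_def]

theorem iterate_C_mul_X_comp (a : R) (n : ℕ) : (C a * X).comp^[n] X = C (a ^ n) * X := by
  induction n with
  | zero => simp
  | succ n ih =>
    rw [Function.iterate_succ_apply', ih, mul_comp, C_comp, X_comp, ← mul_assoc, ← C_mul, pow_succ']

theorem compSum_C_mul_X (a : R) (g : k[X]) : compSum (C a * X) g = C (aeval a g) * X := by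
  rw [compSum, aeval_eq_sum_range, map_sum, Finset.sum_mul]
  refine Finset.sum_congr rfl fun n _ => ?_
  rw [iterate_C_mul_X_comp, ← mul_assoc, ← C_mul, Algebra.smul_def]

theorem natDegree_compSum [IsDomain R] [FaithfulSMul k R] {P : R[X]} (hP : 1 < P.natDegree)
    {g : k[X]} (hg : g ≠ 0) : (compSum P g).natDegree = P.natDegree ^ g.natDegree := by
  have hiterate : ∀ n, (P.comp^[n] X).natDegree = P.natDegree ^ n := fun n => by
    rw [natDegree_iterate_comp, natDegree_X, mul_one]
  have hlead : algebraMap k R (g.coeff g.natDegree) ≠ 0 :=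
    (map_ne_zero_iff _ (FaithfulSMul.algebraMap_injective k R)).mpr (leadingCoeff_ne_zero.mpr hg)
  have htop : (C (algebraMap k R (g.coeff g.natDegree)) * P.comp^[g.natDegree] X).natDegree =
      P.natDegree ^ g.natDegree := by
    rw [natDegree_C_mul hlead, hiterate]
  rw [compSum, Finset.sum_range_succ, natDegree_add_eq_right_of_natDegree_lt, htop]
  rw [htop]
  rcases Nat.eq_zero_or_pos g.natDegree with h0 | hpos
  · simp [h0]
  · refine lt_of_le_of_lt (natDegree_sum_le_of_forall_le (n := P.natDegree ^ (g.natDegree - 1)) _ _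
      fun n hn => ?_) (Nat.pow_lt_pow_right hP (by omega))
    have hn_lt := Finset.mem_range.mp hn
    refine (natDegree_C_mul_le _ _).trans ?_
    rw [hiterate]
    exact Nat.pow_le_pow_right (by omega) (by omega)

end IteratedComp

section Additive

variable {R : Type*} [CommRing R] {q r : ℕ} {c : ℕ → R}

/-- The polynomial `c₀ X + c₁ X ^ q + ⋯ + c_r X ^ (q ^ r)`. -/
def additivePoly (q r : ℕ) (c : ℕ → R) : R[X] :=
  ∑ i ∈ Finset.range (r + 1), C (c i) * X ^ q ^ i

theorem derivative_additivePoly (hq : (q : R) = 0) :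
    derivative (additivePoly q r c) = C (c 0) := by
  rw [additivePoly, derivative_sum, Finset.sum_range_succ', Finset.sum_eq_zero]
  · simp
  · intro i _
    rw [derivative_C_mul, derivative_X_pow, pow_succ, Nat.cast_mul, hq]
    simp

theorem natDegree_additivePoly (hq : 1 < q) (hr : 0 < r) (hc : c r ≠ 0) :
    (additivePoly q r c).natDegree = q ^ r := by
  have htop : (C (c r) * X ^ q ^ r).natDegree = q ^ r := natDegree_C_mul_X_pow _ _ hc
  rw [additivePoly, Finset.sum_range_succ, natDegree_add_eq_right_of_natDegree_lt, htop]
  rw [htop]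
  refine lt_of_le_of_lt (natDegree_sum_le_of_forall_le (n := q ^ (r - 1)) _ _ fun n hn => ?_)
    (Nat.pow_lt_pow_right hq (by omega))
  have hn_lt := Finset.mem_range.mp hn
  exact (natDegree_C_mul_X_pow_le _ _).trans (Nat.pow_le_pow_right (by omega) (by omega))

end Additive

theorem aeval'_of_smul_eq_zero {k M : Type*} [CommRing k] [AddCommGroup M] [Module k M]
    {u : Module.End k M} {g : k[X]} {x : M} :
    g • Module.AEval'.of u x = 0 ↔ aeval u g x = 0 := by
  rw [← Module.AEval.of_aeval_smul, LinearEquiv.map_eq_zero_iff, Module.End.smul_def]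

section Torsion

variable {F L : Type*} [Field F] [Fintype F] [Field L] [Algebra F L] {r : ℕ} {c : ℕ → L}

theorem eval_additivePoly (x : L) :
    (additivePoly (Fintype.card F) r c).eval x = frobSkewOp F r c x := by
  rw [frobSkewOp_apply, additivePoly, eval_finsetSum]
  simp only [eval_mul, eval_C, eval_pow, eval_X]

variable {g : F[X]}

theorem natDegree_compSum_additivePoly (hc : 0 < r → c r ≠ 0) (hg : aeval (c 0) g ≠ 0) :
    (compSum (additivePoly (Fintype.card F) r c) g).natDegree =
      Fintype.card F ^ (r * g.natDegree) := by
  rcases Nat.eq_zero_or_pos r with rfl | hr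
  · have hlin : additivePoly (Fintype.card F) 0 c = C (c 0) * X := by simp [additivePoly]
    rw [hlin, compSum_C_mul_X, natDegree_C_mul_X _ hg, zero_mul, pow_zero]
  · have hdeg := natDegree_additivePoly (Fintype.one_lt_card (α := F)) hr (hc hr)
    rw [natDegree_compSum, hdeg, pow_mul]
    · rw [hdeg]
      exact Nat.one_lt_pow hr.ne' Fintype.one_lt_card
    · rintro rfl
      exact hg (map_zero _)

theorem separable_compSum_additivePoly (hg : aeval (c 0) g ≠ 0) :
    (compSum (additivePoly (Fintype.card F) r c) g).Separable := by
  have hcard : ((Fintype.card F : ℕ) : L) = 0 := by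
    rw [← map_natCast (algebraMap F L), FiniteField.cast_card_eq_zero, map_zero]
  rw [Polynomial.Separable, derivative_compSum (derivative_additivePoly hcard)]
  exact isCoprime_one_right.of_isCoprime_of_dvd_right (isUnit_C.mpr hg.isUnit).dvd

variable [IsAlgClosed L]

theorem card_setOf_aeval_frobSkewOp_eq_zero (hc : 0 < r → c r ≠ 0) (hg : aeval (c 0) g ≠ 0) :
    Nat.card {x : L | aeval (frobSkewOp F r c) g x = 0} =
      Fintype.card F ^ (r * g.natDegree) := by
  have hsep := separable_compSum_additivePoly (r := r) hg
  rw [← natDegree_compSum_additivePoly hc hg, ← card_rootSet_eq_natDegree (K := L) hsep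
    (IsAlgClosed.splits _), ← Nat.card_eq_fintype_card]
  refine Nat.card_congr (Equiv.subtypeEquivRight fun x => ?_)
  rw [mem_rootSet_of_ne hsep.ne_zero, coe_aeval_eq_eval, eval_compSum eval_additivePoly]
  rfl

theorem exists_smul_eq (hc : 0 < r → c r ≠ 0) (hg : aeval (c 0) g ≠ 0)
    (x : Module.AEval' (frobSkewOp F r c)) : ∃ y, g • y = x := by
  obtain ⟨x, rfl⟩ := (Module.AEval'.of (frobSkewOp F r c)).surjective x
  have hdeg : (compSum (additivePoly (Fintype.card F) r c) g - C x).degree ≠ 0 := by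
    intro h0
    have hnat := natDegree_eq_of_degree_eq_some (n := 0) h0
    rw [natDegree_sub_C, natDegree_compSum_additivePoly hc hg] at hnat
    exact (pow_pos Fintype.card_pos _).ne' hnat
  obtain ⟨y, hy⟩ := IsAlgClosed.exists_root _ hdeg
  rw [IsRoot, eval_sub, eval_C, sub_eq_zero, eval_compSum eval_additivePoly] at hy
  exact ⟨Module.AEval'.of _ y, by rw [← Module.AEval.of_aeval_smul, Module.End.smul_def, hy]⟩

theorem exists_isTorsionBasis {h : F[X]} (hirr : Irreducible h) (hc : 0 < r → c r ≠ 0)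
    (hh : aeval (c 0) h ≠ 0) :
    ∃ e : Fin r → Module.AEval' (frobSkewOp F r c), IsTorsionBasis h e := by
  let V := Submodule.torsionBy F[X] (Module.AEval' (frobSkewOp F r c)) h
  have hfield : IsField (F[X] ⧸ Ideal.span {h}) :=
    (Ideal.Quotient.maximal_ideal_iff_isField_quotient _).mp
      (PrincipalIdealRing.isMaximal_of_irreducible hirr)
  have hcard : Nat.card (F[X] ⧸ Ideal.span {h}) = Fintype.card F ^ h.natDegree := by
    have : Module.Finite F (F[X] ⧸ Ideal.span {h}) :=
      Module.finite_of_finrank_pos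
        (by rw [finrank_quotient_span_eq_natDegree]; exact hirr.natDegree_pos)
    rw [Module.natCard_eq_pow_finrank (K := F), finrank_quotient_span_eq_natDegree,
      Nat.card_eq_fintype_card]
  have hV : Nat.card V = Fintype.card F ^ (r * h.natDegree) := by
    rw [← card_setOf_aeval_frobSkewOp_eq_zero (F := F) (L := L) hc hh]
    exact (Nat.card_congr ((Module.AEval'.of (frobSkewOp F r c)).toEquiv.subtypeEquiv
      fun x => aeval'_of_smul_eq_zero.symm)).symm
  have hfin : Finite V := Nat.finite_of_card_ne_zero (by
    rw [hV]; exact (pow_pos Fintype.card_pos _).ne')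
  obtain ⟨b⟩ := exists_basis_of_isField (V := V) (n := r) hfield
    (by rw [hcard]; exact Nat.one_lt_pow hirr.natDegree_pos.ne' Fintype.one_lt_card)
    (by rw [hV, hcard, ← pow_mul, mul_comm])
  exact ⟨_, .of_basis b⟩

end Torsion

/-! ### Anderson generating functions modulo `g` -/

section GeneratingFunction

variable {k : Type*} (R : Type*) [CommRing k] [CommRing R] [Algebra k R] (g : k[X])

/-- The ring `R[T] / g(T)`, in which the generating functions of the points of level `g` live. -/
abbrev LevelRing := AdjoinRoot (g.map (algebraMap k R))

/-- The class of `T` in `R[T] / g(T)`. -/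
abbrev levelT : LevelRing R g := AdjoinRoot.root _

/-- The inclusion of the constants in `R[T] / g(T)`. -/
abbrev levelC : R →ₐ[k] LevelRing R g := AdjoinRoot.ofAlgHom k _

/-- The reduction `k[T] → R[T] / g(T)`. -/
abbrev levelEval : k[X] →+* LevelRing R g := (aeval (levelT R g) : k[X] →ₐ[k] _).toRingHom

theorem levelEval_eq_mk (a : k[X]) :
    levelEval R g a = AdjoinRoot.mk (g.map (algebraMap k R)) (a.map (algebraMap k R)) := by
  rw [← AdjoinRoot.aeval_eq, aeval_map_algebraMap]
  rfl

theorem aeval_levelT_self : aeval (levelT R g) g = 0 :=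
  (levelEval_eq_mk R g g).trans AdjoinRoot.mk_self

variable {R g}

/-- The coefficient of `T ^ (deg g - 1)` of an element of `R[T] / g(T)`. -/
def topCoeff (hg : g.Monic) : LevelRing R g →ₗ[R] R :=
  lcoeff R (g.natDegree - 1) ∘ₗ AdjoinRoot.modByMonicHom (hg.map (algebraMap k R))

theorem topCoeff_mul_pow (hg : g.Monic) (c : R) {j : ℕ} (hj : j < g.natDegree) :
    topCoeff hg (levelC R g c * levelT R g ^ j) = if j = g.natDegree - 1 then c else 0 := by
  nontriviality R
  have hmk : levelC R g c * levelT R g ^ j = AdjoinRoot.mk _ (C c * X ^ j) := by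
    rw [map_mul, map_pow, AdjoinRoot.mk_X, AdjoinRoot.mk_C, AdjoinRoot.coe_ofAlgHom]
  rw [hmk, topCoeff, LinearMap.comp_apply, AdjoinRoot.modByMonicHom_mk, lcoeff_apply,
    (modByMonic_eq_self_iff (hg.map _)).mpr, coeff_C_mul, coeff_X_pow]
  · simp [eq_comm]
  · refine (degree_C_mul_X_pow_le _ _).trans_lt ?_
    rw [hg.degree_map, degree_eq_natDegree (hg.ne_zero_of_ne (by
      rintro h
      exact zero_ne_one (α := R) (by rw [← map_zero (algebraMap k R), h, map_one])))]
    exact_mod_cast hj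

variable (u : Module.End k R)

variable (g) in
/-- The Anderson generating function `(g(u) - g(T)) / (u - T)` applied to `x`, modulo `g(T)`. -/
def genFun : R →ₗ[k] LevelRing R g :=
  ∑ n ∈ Finset.range (g.natDegree + 1), g.coeff n • ∑ i ∈ Finset.range n,
    LinearMap.mulRight k (levelT R g ^ (n - 1 - i)) ∘ₗ (levelC R g).toLinearMap ∘ₗ u ^ i

theorem genFun_apply (x : R) : genFun g u x =
    ∑ n ∈ Finset.range (g.natDegree + 1), g.coeff n • ∑ i ∈ Finset.range n,
      levelC R g ((u ^ i) x) * levelT R g ^ (n - 1 - i) := by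
  simp [genFun, LinearMap.sum_apply]

variable (g) in
theorem sum_levelC_mul_levelT_sub (x : R) (n : ℕ) :
    ∑ i ∈ Finset.range n, levelC R g ((u ^ i) (u x)) * levelT R g ^ (n - 1 - i) -
      levelT R g * ∑ i ∈ Finset.range n, levelC R g ((u ^ i) x) * levelT R g ^ (n - 1 - i) =
    levelC R g ((u ^ n) x) - levelC R g x * levelT R g ^ n := by
  have htelescope := Finset.sum_range_sub
    (fun i => levelC R g ((u ^ i) x) * levelT R g ^ (n - i)) n
  simp only [Nat.sub_self, pow_zero, mul_one, Nat.sub_zero, Module.End.one_apply] at htelescope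
  rw [← htelescope, Finset.mul_sum, ← Finset.sum_sub_distrib]
  refine Finset.sum_congr rfl fun i hi => ?_
  have hin := Finset.mem_range.mp hi
  rw [show n - i = n - 1 - i + 1 by omega, show n - (i + 1) = n - 1 - i by omega,
    ← Module.End.mul_apply, ← pow_succ]
  ring

variable {u} {x : R}

theorem genFun_end_apply (hx : aeval u g x = 0) :
    genFun g u (u x) = levelT R g * genFun g u x := by
  have hgu : ∑ n ∈ Finset.range (g.natDegree + 1), g.coeff n • levelC R g ((u ^ n) x) = 0 := by
    rw [← map_zero (levelC R g), ← hx, aeval_eq_sum_range]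
    simp only [LinearMap.sum_apply, LinearMap.smul_apply, map_sum, map_smul]
  have hgT : ∑ n ∈ Finset.range (g.natDegree + 1),
      g.coeff n • (levelC R g x * levelT R g ^ n) = 0 := by
    simp only [← mul_smul_comm, ← Finset.mul_sum]
    rw [← aeval_eq_sum_range, aeval_levelT_self, mul_zero]
  rw [← sub_eq_zero, genFun_apply, genFun_apply, Finset.mul_sum, ← Finset.sum_sub_distrib]
  simp only [mul_smul_comm, ← smul_sub, sum_levelC_mul_levelT_sub]
  simp only [smul_sub, Finset.sum_sub_distrib, hgu, hgT, sub_zero]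

theorem genFun_aeval (hx : aeval u g x = 0) (a : k[X]) :
    genFun g u (aeval u a x) = aeval (levelT R g) a * genFun g u x := by
  induction a using Polynomial.induction_on' with
  | add a b ha hb => rw [map_add, LinearMap.add_apply, map_add, ha, hb, map_add, add_mul]
  | monomial n b =>
    induction n with
    | zero =>
      rw [monomial_zero_left, aeval_C, aeval_C, Module.algebraMap_end_apply, map_smul,
        Algebra.smul_def]
    | succ n ih =>
      have hcomm : aeval u g (aeval u (monomial n b) x) = 0 := by
        rw [← Module.End.mul_apply, ← map_mul, mul_comm, map_mul, Module.End.mul_apply, hx,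
          map_zero]
      rw [← X_mul_monomial, map_mul, Module.End.mul_apply, aeval_X, genFun_end_apply hcomm, ih,
        map_mul, aeval_X, mul_assoc]

end GeneratingFunction

section Frobenius

variable {F : Type*} [Field F] [Fintype F] {R : Type*} [CommRing R] [Algebra F R] {g : F[X]}

variable (R g) in
/-- The Frobenius `c ↦ c ^ q` on the coefficients of the elements of `R[T] / g(T)`. -/
def levelFrob : LevelRing R g →ₐ[F] LevelRing R g :=
  AdjoinRoot.liftAlgHom _ ((levelC R g).comp (FiniteField.frobeniusAlgHom F R)) (levelT R g) <| by
    rw [eval₂_map]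
    have hcomp : ((levelC R g).comp (FiniteField.frobeniusAlgHom F R) :
        R →+* LevelRing R g).comp (algebraMap F R) = algebraMap F (LevelRing R g) :=
      AlgHom.comp_algebraMap _
    rw [hcomp]
    exact aeval_levelT_self R g

theorem levelFrob_pow_levelC (j : ℕ) (c : R) :
    (levelFrob R g ^ j) (levelC R g c) = levelC R g (c ^ Fintype.card F ^ j) := by
  induction j with
  | zero => simp
  | succ j ih =>
    rw [pow_succ', AlgHom.mul_apply, ih, levelFrob, AdjoinRoot.coe_ofAlgHom,
      AdjoinRoot.liftAlgHom_of, AlgHom.comp_apply, FiniteField.frobeniusAlgHom_apply, ← pow_mul,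
      pow_succ, AdjoinRoot.coe_ofAlgHom]

theorem levelFrob_pow_levelT (j : ℕ) : (levelFrob R g ^ j) (levelT R g) = levelT R g := by
  induction j with
  | zero => simp
  | succ j ih => rw [pow_succ', AlgHom.mul_apply, ih, levelFrob, AdjoinRoot.liftAlgHom_root]

theorem levelFrob_pow_aeval (j : ℕ) (a : F[X]) :
    (levelFrob R g ^ j) (aeval (levelT R g) a) = aeval (levelT R g) a := by
  rw [← aeval_algHom_apply, levelFrob_pow_levelT]

theorem levelFrob_pow_genFun (u : Module.End F R) (j : ℕ) (x : R) :
    (levelFrob R g ^ j) (genFun g u x) =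
      ∑ n ∈ Finset.range (g.natDegree + 1), g.coeff n • ∑ i ∈ Finset.range n,
        levelC R g ((u ^ i) x ^ Fintype.card F ^ j) * levelT R g ^ (n - 1 - i) := by
  simp only [genFun_apply, map_sum, map_smul, map_mul, map_pow (levelFrob R g ^ j),
    levelFrob_pow_levelC, levelFrob_pow_levelT]

theorem topCoeff_levelFrob_pow_genFun (hg : g.Monic) (hpos : 0 < g.natDegree)
    (u : Module.End F R) (j : ℕ) (x : R) :
    topCoeff hg ((levelFrob R g ^ j) (genFun g u x)) = x ^ Fintype.card F ^ j := by
  have hterm : ∀ n ≤ g.natDegree, ∀ i < n,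
      topCoeff hg (levelC R g ((u ^ i) x ^ Fintype.card F ^ j) * levelT R g ^ (n - 1 - i)) =
        if n = g.natDegree ∧ i = 0 then x ^ Fintype.card F ^ j else 0 := by
    intro n hn i hi
    rw [topCoeff_mul_pow hg _ (by omega)]
    rcases Nat.eq_zero_or_pos i with rfl | h0
    · exact if_congr (by omega) rfl rfl
    · rw [if_neg (by omega), if_neg (by omega)]
  rw [levelFrob_pow_genFun, map_sum, Finset.sum_range_succ, Finset.sum_eq_zero, zero_add,
    LinearMap.map_smul_of_tower, hg.coeff_natDegree, one_smul, map_sum, Finset.sum_eq_single 0]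
  · rw [hterm _ le_rfl _ hpos, if_pos ⟨rfl, rfl⟩]
  · intro i hi h0
    rw [hterm _ le_rfl _ (Finset.mem_range.mp hi), if_neg (fun h => h0 h.2)]
  · exact fun h => absurd (Finset.mem_range.mpr hpos) h
  · intro n hn
    have hlt := Finset.mem_range.mp hn
    rw [LinearMap.map_smul_of_tower, map_sum, Finset.sum_eq_zero, smul_zero]
    intro i hi
    rw [hterm n hlt.le i (Finset.mem_range.mp hi), if_neg (fun h => hlt.ne h.1)]

variable {r : ℕ} {c : ℕ → R}

theorem levelFrob_pow_genFun_of_pow_eq {d : ℕ} (hc : ∀ i, c i ^ Fintype.card F ^ d = c i) (x : R) :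
    (levelFrob R g ^ d) (genFun g (frobSkewOp F r c) x) =
      genFun g (frobSkewOp F r c) (x ^ Fintype.card F ^ d) := by
  rw [levelFrob_pow_genFun, genFun_apply]
  simp only [frobSkewOp_pow_apply_pow r hc]

theorem genFun_frobSkewOp_apply (x : R) :
    genFun g (frobSkewOp F r c) (frobSkewOp F r c x) = ∑ i ∈ Finset.range (r + 1),
      levelC R g (c i) * (levelFrob R g ^ i) (genFun g (frobSkewOp F r c) x) := by
  simp only [levelFrob_pow_genFun]
  rw [genFun_apply]
  simp only [Finset.mul_sum, mul_smul_comm]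
  rw [Finset.sum_comm]
  refine Finset.sum_congr rfl fun n _ => ?_
  rw [← Finset.smul_sum, Finset.sum_comm]
  congr 1
  refine Finset.sum_congr rfl fun i _ => ?_
  rw [← Module.End.mul_apply, ← pow_succ, pow_succ', Module.End.mul_apply, frobSkewOp_apply,
    map_sum, Finset.sum_mul]
  simp only [map_mul, mul_assoc]

theorem levelT_mul_levelFrob_pow_genFun {x : R} (hx : aeval (frobSkewOp F r c) g x = 0) (j : ℕ) :
    levelT R g * (levelFrob R g ^ j) (genFun g (frobSkewOp F r c) x) =
      ∑ i ∈ Finset.range (r + 1), levelC R g (c i) ^ Fintype.card F ^ j *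
        (levelFrob R g ^ (j + i)) (genFun g (frobSkewOp F r c) x) := by
  rw [← levelFrob_pow_levelT (R := R) (g := g) j, ← map_mul, ← genFun_end_apply hx,
    genFun_frobSkewOp_apply, map_sum]
  refine Finset.sum_congr rfl fun i _ => ?_
  rw [map_mul, levelFrob_pow_levelC, map_pow, pow_add, AlgHom.mul_apply]

variable {r' : ℕ} {E : Fin r' → R}

/-- The vector of the `n`-th Frobenius twists of the generating functions of the points `E l`. -/
def genVec (g : F[X]) (u : Module.End F R) (E : Fin r' → R) (n : ℕ) : Fin r' → LevelRing R g :=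
  fun l => (levelFrob R g ^ n) (genFun g u (E l))

theorem sum_smul_genVec (hE : ∀ l, aeval (frobSkewOp F r c) g (E l) = 0) (n : ℕ) :
    ∑ i ∈ Finset.range (r + 1), levelC R g (c i) ^ Fintype.card F ^ n •
      genVec g (frobSkewOp F r c) E (n + i) = levelT R g • genVec g (frobSkewOp F r c) E n := by
  funext l
  simp only [Finset.sum_apply, Pi.smul_apply, smul_eq_mul, genVec,
    levelT_mul_levelFrob_pow_genFun (hE l)]

theorem genVec_add {d : ℕ} (hc : ∀ i, c i ^ Fintype.card F ^ d = c i)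
    (hE : ∀ l, aeval (frobSkewOp F r c) g (E l) = 0) {G : Matrix (Fin r') (Fin r') F[X]}
    (hG : ∀ j, E j ^ Fintype.card F ^ d = ∑ i, aeval (frobSkewOp F r c) (G i j) (E i)) (n : ℕ) :
    genVec g (frobSkewOp F r c) E (n + d) =
      (G.transpose.map (levelEval R g)).mulVec (genVec g (frobSkewOp F r c) E n) := by
  funext l
  simp only [genVec, Matrix.mulVec, dotProduct, Matrix.map_apply, Matrix.transpose_apply]
  rw [pow_add, AlgHom.mul_apply, levelFrob_pow_genFun_of_pow_eq hc, hG, map_sum, map_sum]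
  refine Finset.sum_congr rfl fun i _ => ?_
  rw [genFun_aeval (hE i), map_mul, levelFrob_pow_aeval]
  rfl

end Frobenius

section CyclicRelation

variable {ι S : Type*} [Fintype ι] [DecidableEq ι] [CommRing S] {A : Matrix ι ι S}
  {v : ℕ → ι → S} {d : ℕ}

theorem toMatrix_lsmul_X (A : Matrix ι ι S) :
    LinearMap.toMatrix ((Pi.basisFun S ι).map (Module.AEval'.of A.toLin'))
      ((Pi.basisFun S ι).map (Module.AEval'.of A.toLin'))
      (Algebra.lsmul S S (Module.AEval' A.toLin') (X : S[X])) = A := by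
  ext i j
  have hX : Algebra.lsmul S S (Module.AEval' A.toLin') (X : S[X])
      (Module.AEval'.of A.toLin' (Pi.basisFun S ι j)) =
      Module.AEval'.of A.toLin' (A.toLin' (Pi.basisFun S ι j)) := Module.AEval'.X_smul_of _ _
  rw [LinearMap.toMatrix_apply, Module.Basis.map_apply, hX]
  simp

theorem span_range_AEval'_of (hd : 0 < d) (hv : ∀ n, v (n + d) = A.mulVec (v n))
    (hspan : Submodule.span S (Set.range v) = ⊤) :
    Submodule.span S[X] (Set.range fun j : Fin d => Module.AEval'.of A.toLin' (v j)) = ⊤ := by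
  set V := Submodule.span S[X] (Set.range fun j : Fin d => Module.AEval'.of A.toLin' (v j))
  have hmem : ∀ n, Module.AEval'.of A.toLin' (v n) ∈ V := by
    intro n
    induction n using Nat.strong_induction_on with
    | _ n ih =>
      rcases lt_or_ge n d with hn | hn
      · exact Submodule.subset_span ⟨⟨n, hn⟩, rfl⟩
      · rw [← Nat.sub_add_cancel hn, hv, ← Matrix.toLin'_apply, ← Module.AEval'.X_smul_of]
        exact V.smul_mem _ (ih _ (by omega))
  rw [← Submodule.restrictScalars_eq_top_iff S, eq_top_iff, ← (Module.AEval'.of A.toLin').range,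
    LinearMap.range_eq_map, ← hspan, Submodule.map_span, Submodule.span_le]
  rintro _ ⟨_, ⟨n, rfl⟩, rfl⟩
  exact hmem n

theorem charpoly_dvd_twistDet (hd : 0 < d) (hv : ∀ n, v (n + d) = A.mulVec (v n))
    (hspan : Submodule.span S (Set.range v) = ⊤) {q r : ℕ} {c : ℕ → S} {T : S}
    (hT : ∀ n, ∑ i ∈ Finset.range (r + 1), c i ^ q ^ n • v (n + i) = T • v n) :
    A.charpoly ∣ twistDet q d r (fun i => C (c i)) (C T) X := by
  rw [← toMatrix_lsmul_X A, twistDet]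
  refine charpoly_dvd_det _ _ (span_range_AEval'_of hd hv hspan) _ fun j => ?_
  have hrel := twistMatrix_smul (v := fun n => Module.AEval'.of A.toLin' (v n)) (x := (X : S[X])) hd
    (fun n => by rw [Module.AEval'.X_smul_of, Matrix.toLin'_apply, hv]) q r (fun i => C (c i)) j
  simp only [Matrix.sub_apply, sub_smul, Finset.sum_sub_distrib, Matrix.scalar_apply,
    Matrix.diagonal_apply, ite_smul, zero_smul, Finset.sum_ite_eq, Finset.mem_univ, if_true]
  rw [hrel, sub_eq_zero]
  simp only [← C_pow, Module.AEval.C_smul, ← map_smul, ← map_sum, hT]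

end CyclicRelation

theorem exists_sum_aeval_eq {k M ι : Type*} [CommRing k] [AddCommGroup M] [Module k M]
    [Fintype ι] {u : Module.End k M} {g : k[X]} {E : ι → M}
    (hE : IsTorsionBasis g fun l => Module.AEval'.of u (E l)) {x : M} (hx : aeval u g x = 0) :
    ∃ a : ι → k[X], ∑ l, aeval u (a l) (E l) = x := by
  obtain ⟨a, ha⟩ := hE.exists_sum_smul_eq _ (aeval'_of_smul_eq_zero.mpr hx)
  refine ⟨a, (Module.AEval'.of u).injective ?_⟩
  simp only [← Module.AEval.of_aeval_smul, ← map_sum, Module.End.smul_def] at ha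
  exact ha

section Level

variable {F L : Type*} [Field F] [Field L] [Algebra F L] {g : F[X]} {r : ℕ} {c : ℕ → L}
  {E : Fin r → L}

theorem levelEval_eq_zero_iff {a : F[X]} : levelEval L g a = 0 ↔ g ∣ a := by
  rw [levelEval_eq_mk, AdjoinRoot.mk_eq_zero, map_dvd_map']

theorem eq_zero_of_sum_mul_pow {q N : ℕ} (hq : 1 < q) {a : Fin N → L} {V : Set L}
    (hV : Nat.card V = q ^ N) (h : ∀ x ∈ V, ∑ j, a j * x ^ q ^ (j : ℕ) = 0) (j : Fin N) :
    a j = 0 := by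
  have hN : 0 < N := j.pos
  let p : L[X] := ∑ j, C (a j) * X ^ q ^ (j : ℕ)
  have hp : p = 0 := by
    by_contra hp
    have hsub : V ⊆ p.rootSet L := fun x hx => by
      rw [mem_rootSet_of_ne hp]
      simpa [p] using h x hx
    have hcard : Nat.card V ≤ p.natDegree := by
      rw [Nat.card_coe_set_eq]
      exact (Set.ncard_le_ncard hsub (rootSet_finite _ _)).trans (ncard_rootSet_le _ _)
    have hdeg : p.natDegree ≤ q ^ (N - 1) := natDegree_sum_le_of_forall_le _ _ fun i _ =>
      (natDegree_C_mul_X_pow_le _ _).trans (Nat.pow_le_pow_right (by omega) (by omega))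
    have hlt : q ^ (N - 1) < q ^ N := Nat.pow_lt_pow_right hq (by omega)
    omega
  have hcoeff : p.coeff (q ^ (j : ℕ)) = a j := by
    simp only [p, finsetSum_coeff, coeff_C_mul, coeff_X_pow, (Nat.pow_right_injective hq).eq_iff,
      Fin.val_inj, mul_ite, mul_one, mul_zero, Finset.sum_ite_eq, Finset.mem_univ, if_true]
  rw [← hcoeff, hp, coeff_zero]

variable [Fintype F] [IsAlgClosed L]

theorem linearIndependent_genVec (hcr : 0 < r → c r ≠ 0) (hc0 : aeval (c 0) g ≠ 0)
    (hg : g.Monic) (hpos : 0 < g.natDegree)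
    (hE : IsTorsionBasis g fun l => Module.AEval'.of (frobSkewOp F r c) (E l)) :
    LinearIndependent L fun j : Fin (r * g.natDegree) => genVec g (frobSkewOp F r c) E j := by
  rw [Fintype.linearIndependent_iff]
  intro b hb
  have htors : ∀ l, aeval (frobSkewOp F r c) g (E l) = 0 := fun l =>
    aeval'_of_smul_eq_zero.mp (hE.smul_eq_zero l)
  have hbasis : ∀ l, ∑ j : Fin (r * g.natDegree),
      b j • (levelFrob L g ^ (j : ℕ)) (genFun g (frobSkewOp F r c) (E l)) = 0 := fun l => by
    simpa [genVec, Finset.sum_apply] using congrFun hb l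
  have hpoint : ∀ x, aeval (frobSkewOp F r c) g x = 0 → ∑ j : Fin (r * g.natDegree),
      b j • (levelFrob L g ^ (j : ℕ)) (genFun g (frobSkewOp F r c) x) = 0 := by
    intro x hx
    obtain ⟨a, rfl⟩ := exists_sum_aeval_eq hE hx
    simp only [map_sum, genFun_aeval (htors _), map_mul, levelFrob_pow_aeval, Finset.smul_sum]
    rw [Finset.sum_comm]
    refine Finset.sum_eq_zero fun l _ => ?_
    simp only [← mul_smul_comm]
    rw [← Finset.mul_sum, hbasis, mul_zero]
  refine eq_zero_of_sum_mul_pow Fintype.one_lt_card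
    (card_setOf_aeval_frobSkewOp_eq_zero hcr hc0) fun x hx => ?_
  simpa only [map_sum, map_smul, topCoeff_levelFrob_pow_genFun hg hpos, smul_eq_mul, map_zero]
    using congrArg (topCoeff hg) (hpoint x hx)

theorem span_genVec (hcr : 0 < r → c r ≠ 0) (hc0 : aeval (c 0) g ≠ 0)
    (hg : g.Monic) (hpos : 0 < g.natDegree)
    (hE : IsTorsionBasis g fun l => Module.AEval'.of (frobSkewOp F r c) (E l)) :
    Submodule.span L (Set.range (genVec g (frobSkewOp F r c) E)) = ⊤ := by
  have hfin : Module.Finite L (LevelRing L g) := (hg.map _).finite_adjoinRoot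
  have hrank : Module.finrank L (Fin r → LevelRing L g) = r * g.natDegree := by
    rw [Module.finrank_pi_fintype]
    simp [(AdjoinRoot.powerBasis' (hg.map (algebraMap F L))).finrank]
  rw [eq_top_iff, ← (linearIndependent_genVec hcr hc0 hg hpos hE).span_eq_top_of_card_eq_finrank'
    (by rw [hrank, Fintype.card_fin])]
  refine Submodule.span_mono ?_
  rintro _ ⟨j, rfl⟩
  exact ⟨j, rfl⟩

theorem charpoly_map_levelEval_dvd (hcr : 0 < r → c r ≠ 0) (hc0 : aeval (c 0) g ≠ 0)
    (hg : g.Monic) (hpos : 0 < g.natDegree)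
    (hE : IsTorsionBasis g fun l => Module.AEval'.of (frobSkewOp F r c) (E l))
    {d : ℕ} (hd : 0 < d)
    (hc : ∀ i, c i ^ Fintype.card F ^ d = c i) {G : Matrix (Fin r) (Fin r) F[X]}
    (hG : ∀ j, E j ^ Fintype.card F ^ d = ∑ i, aeval (frobSkewOp F r c) (G i j) (E i)) :
    G.charpoly.map (levelEval L g) ∣ twistDet (Fintype.card F) d r
      (fun i => C (levelC L g (c i))) (C (levelT L g)) X := by
  have htors : ∀ l, aeval (frobSkewOp F r c) g (E l) = 0 := fun l =>
    aeval'_of_smul_eq_zero.mp (hE.smul_eq_zero l)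
  rw [← Matrix.charpoly_transpose, ← Matrix.charpoly_map]
  exact charpoly_dvd_twistDet hd (genVec_add hc htors hG)
    (Submodule.span_eq_top_of_span_eq_top L _ _ (span_genVec hcr hc0 hg hpos hE))
    (sum_smul_genVec htors)

end Level

/-! ### The polynomials `P_f` and `D_f` -/

theorem charpoly_toMatrix_eq {R M ι κ : Type*} [CommRing R] [AddCommGroup M] [Module R M]
    [Fintype ι] [DecidableEq ι] [Fintype κ] [DecidableEq κ] (b : Module.Basis ι R M)
    (b' : Module.Basis κ R M) (u : M →ₗ[R] M) :
    (LinearMap.toMatrix b b u).charpoly = (LinearMap.toMatrix b' b' u).charpoly := by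
  have hfree : Module.Free R M := Module.Free.of_basis b
  have hfinite : Module.Finite R M := Module.Finite.of_basis b
  nontriviality R
  rw [LinearMap.charpoly_toMatrix, LinearMap.charpoly_toMatrix]

theorem algebraMap_adicCompletion_injective {R : Type*} [CommRing R] [IsDomain R]
    [WfDvdMonoid R] {h : R} (hh : ¬ IsUnit h) :
    Function.Injective (algebraMap R (AdicCompletion (Ideal.span {h}) R)) := by
  rw [injective_iff_map_eq_zero]
  intro a ha
  by_contra h0
  have hfin : FiniteMultiplicity h a := FiniteMultiplicity.of_not_isUnit hh h0
  refine hfin.not_pow_dvd_of_multiplicity_lt (Nat.lt_succ_self _) ?_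
  have heval := congrArg (AdicCompletion.evalₐ (Ideal.span {h}) (multiplicity h a + 1)) ha
  rw [AlgHom.commutes, map_zero] at heval
  rwa [← Ideal.mem_span_singleton, ← Ideal.span_singleton_pow, ← Ideal.Quotient.eq_zero_iff_mem]

section FrobPoly

variable {F : Type*} [Field F] (φ : DrinfeldModule F) (f : MonicIrred F)

theorem exists_monicIrred_ne : ∃ h : MonicIrred F, h ≠ f := by
  let linear : F → MonicIrred F := fun a => ⟨X - C a, monic_X_sub_C a, irreducible_X_sub_C a⟩
  have hne : linear 0 ≠ linear 1 := fun h => zero_ne_one (α := F)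
    (C_injective (sub_right_injective (congrArg Subtype.val h)))
  by_cases h : linear 0 = f
  · exact ⟨linear 1, fun h' => hne (h.trans h'.symm)⟩
  · exact ⟨linear 0, h⟩

variable {f} in
theorem not_dvd_of_ne {h : MonicIrred F} (hne : h ≠ f) : ¬ f.1 ∣ h.1 := fun hdvd =>
  hne (Subtype.ext (eq_of_monic_of_associated h.2.1 f.2.1
    ((f.2.2.associated_of_dvd h.2.2 hdvd).symm)))

/-- The coefficients of the reduction of `φ_θ` modulo `f`, in the algebraic closure of `A / f A`. -/
def resCoeff (i : ℕ) : ResClosure f := algebraMap (AdjoinRoot f.1) (ResClosure f) (redCoeff φ f i)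

theorem resCoeff_redRank_ne_zero (h : 0 < redRank φ f) : resCoeff φ f (redRank φ f) ≠ 0 :=
  (_root_.map_ne_zero _).mpr (redCoeff_redRank φ f h)

variable {f} in
theorem aeval_resCoeff_zero_ne_zero {g : F[X]} (hg : ¬ f.1 ∣ g) :
    aeval (resCoeff φ f 0) g ≠ 0 := by
  rw [resCoeff, aeval_algebraMap_apply, redCoeff_zero, AdjoinRoot.aeval_eq]
  exact (_root_.map_ne_zero _).mpr fun h => hg (AdjoinRoot.mk_eq_zero.mp h)

variable [Fintype F]

theorem resCoeff_pow_card_pow (i : ℕ) :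
    resCoeff φ f i ^ Fintype.card F ^ f.1.natDegree = resCoeff φ f i := by
  rw [resCoeff, ← map_pow, pow_card_pow]

theorem redOp_eq : redOp φ f = frobSkewOp F (redRank φ f) (resCoeff φ f) := by
  have hredOp : redOp φ f = frobSkewOp F φ.rank (resCoeff φ f) := rfl
  ext x
  rw [hredOp, frobSkewOp_apply, frobSkewOp_apply]
  symm
  refine Finset.sum_subset (Finset.range_mono (Nat.succ_le_succ (redRank_le φ f))) fun i _ hi => ?_
  rw [resCoeff, redCoeff_of_gt φ f (by simpa using hi), map_zero, zero_mul]

theorem frobEnd_of (x : ResClosure f) : frobEnd φ f (Module.AEval'.of (redOp φ f) x) =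
    Module.AEval'.of (redOp φ f) (x ^ Fintype.card F ^ f.1.natDegree) := by
  rw [← resFrob_pow_apply]
  rfl

theorem map_localPoly_levelEval (g : F[X]) :
    (localPoly φ f).map (levelEval (ResClosure f) g) =
      twistDet (Fintype.card F) f.1.natDegree (redRank φ f)
        (fun i => C (levelC (ResClosure f) g (resCoeff φ f i)))
        (C (levelT (ResClosure f) g)) X := by
  let ε : (AdjoinRoot f.1)[X] →+* LevelRing (ResClosure f) g :=
    eval₂RingHom ((levelC (ResClosure f) g : ResClosure f →+* LevelRing (ResClosure f) g).comp
      (algebraMap (AdjoinRoot f.1) (ResClosure f))) (levelT (ResClosure f) g)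
  have hε : ε.comp (mapRingHom (algebraMap F (AdjoinRoot f.1))) = levelEval (ResClosure f) g := by
    refine Polynomial.ringHom_ext (fun a => ?_) ?_
    · simp only [ε, RingHom.comp_apply, coe_mapRingHom, map_C, coe_eval₂RingHom, eval₂_C,
        ← IsScalarTower.algebraMap_apply]
      exact (aeval_C (levelT (ResClosure f) g) a).symm
    · simp [ε]
  have hC : ∀ c, ε (C c) = levelC (ResClosure f) g (algebraMap _ _ c) := fun c => eval₂_C _ _
  have hX : ε X = levelT (ResClosure f) g := eval₂_X _ _
  rw [← hε, ← map_map, map_localPoly_redRank, twistPoly, ← coe_mapRingHom ε, map_twistDet]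
  simp only [coe_mapRingHom, map_C, map_X, hC, hX]
  rfl

theorem exists_monic_localPoly : ∃ (P : F[X][X]) (a : F), a ≠ 0 ∧ P.Monic ∧
    P.natDegree = redRank φ f ∧ (0 < redRank φ f → P = C (C a) * localPoly φ f) := by
  rcases Nat.eq_zero_or_pos (redRank φ f) with h | h
  · exact ⟨1, 1, one_ne_zero, monic_one, by simp [h], by omega⟩
  · obtain ⟨a, ha, hlead⟩ := coeff_localPoly_redRank φ f h
    refine ⟨C (C a⁻¹) * localPoly φ f, a⁻¹, inv_ne_zero ha, ?_, ?_, fun _ => rfl⟩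
    · rw [Monic, leadingCoeff_mul, leadingCoeff_C, leadingCoeff, natDegree_localPoly, hlead,
        ← C_mul, inv_mul_cancel₀ ha, C_1]
    · rw [natDegree_C_mul (C_ne_zero.mpr (inv_ne_zero ha)), natDegree_localPoly]

/-- The monic multiple of `localPoly` by a constant, which is the characteristic polynomial of the
Frobenius at `f`; it is `1` if the reduction has rank `0`, where `localPoly` is the constant
`f`. -/
def frobCharpoly : F[X][X] := (exists_monic_localPoly φ f).choose

theorem frobCharpoly_spec : ∃ a : F, a ≠ 0 ∧ (frobCharpoly φ f).Monic ∧
    (frobCharpoly φ f).natDegree = redRank φ f ∧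
    (0 < redRank φ f → frobCharpoly φ f = C (C a) * localPoly φ f) :=
  (exists_monic_localPoly φ f).choose_spec

variable {f}

theorem map_charpoly_dvd_map_localPoly {g : F[X]} (hg : g.Monic) (hpos : 0 < g.natDegree)
    (hfg : ¬ f.1 ∣ g) {E : Fin (redRank φ f) → RedModule φ f} (hE : IsTorsionBasis g E)
    {G : Matrix (Fin (redRank φ f)) (Fin (redRank φ f)) F[X]}
    (hG : ∀ j, frobEnd φ f (E j) = ∑ i, G i j • E i) :
    G.charpoly.map (levelEval (ResClosure f) g) ∣
      (localPoly φ f).map (levelEval (ResClosure f) g) := by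
  obtain ⟨E, rfl⟩ : ∃ E' : Fin (redRank φ f) → ResClosure f,
      (fun l => Module.AEval'.of (redOp φ f) (E' l)) = E :=
    ⟨fun l => (Module.AEval'.of (redOp φ f)).symm (E l), by simp⟩
  have hfrob : ∀ j, E j ^ Fintype.card F ^ f.1.natDegree =
      ∑ i, aeval (redOp φ f) (G i j) (E i) := fun j => by
    apply (Module.AEval'.of (redOp φ f)).injective
    rw [← frobEnd_of, hG, map_sum]
    rfl
  rw [redOp_eq] at hE hfrob
  rw [map_localPoly_levelEval]
  exact charpoly_map_levelEval_dvd (resCoeff_redRank_ne_zero φ f)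
    (aeval_resCoeff_zero_ne_zero φ hfg) hg hpos hE (natDegree_pos f) (resCoeff_pow_card_pow φ f)
    hfrob

theorem dvd_coeff_charpoly_sub_frobCharpoly {g : F[X]} (hg : g.Monic) (hfg : ¬ f.1 ∣ g)
    {E : Fin (redRank φ f) → RedModule φ f} (hE : IsTorsionBasis g E)
    {G : Matrix (Fin (redRank φ f)) (Fin (redRank φ f)) F[X]}
    (hG : ∀ j, frobEnd φ f (E j) = ∑ i, G i j • E i) (n : ℕ) :
    g ∣ (G.charpoly - frobCharpoly φ f).coeff n := by
  rcases Nat.eq_zero_or_pos g.natDegree with h0 | hgpos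
  · rw [hg.natDegree_eq_zero.mp h0]
    exact one_dvd _
  obtain ⟨a, -, hmonic, hdeg, hloc⟩ := frobCharpoly_spec φ f
  have hGdeg : G.charpoly.natDegree = redRank φ f := by
    rw [Matrix.charpoly_natDegree_eq_dim, Fintype.card_fin]
  have hdvd : G.charpoly.map (levelEval (ResClosure f) g) ∣
      (frobCharpoly φ f).map (levelEval (ResClosure f) g) := by
    rcases Nat.eq_zero_or_pos (redRank φ f) with h0 | hpos
    · rw [(Monic.natDegree_eq_zero G.charpoly_monic).mp (hGdeg.trans h0), Polynomial.map_one]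
      exact one_dvd _
    · rw [hloc hpos, Polynomial.map_mul]
      exact (map_charpoly_dvd_map_localPoly φ hg hgpos hfg hE hG).mul_left _
  have hnontrivial : Nontrivial (LevelRing (ResClosure f) g) := AdjoinRoot.nontrivial _ (by
    rw [degree_map, degree_eq_natDegree hg.ne_zero]
    exact_mod_cast hgpos.ne')
  have heq : (frobCharpoly φ f).map (levelEval (ResClosure f) g) =
      G.charpoly.map (levelEval (ResClosure f) g) := by
    refine eq_of_monic_of_dvd_of_natDegree_le (G.charpoly_monic.map _) (hmonic.map _) hdvd ?_
    rw [hmonic.natDegree_map, G.charpoly_monic.natDegree_map, hdeg, hGdeg]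
  rw [← levelEval_eq_zero_iff (L := ResClosure f), ← coeff_map, Polynomial.map_sub, heq, sub_self,
    coeff_zero]

theorem isFrobCharpoly_frobCharpoly {h : MonicIrred F} (hne : h ≠ f) :
    IsFrobCharpoly φ f h (frobCharpoly φ f) := by
  have hrank := resCoeff_redRank_ne_zero φ f
  have hh := aeval_resCoeff_zero_ne_zero φ (not_dvd_of_ne hne)
  have hdiv : ∀ x : RedModule φ f, ∃ y, h.1 • y = x := by
    unfold RedModule
    rw [redOp_eq]
    exact exists_smul_eq hrank hh
  obtain ⟨e, he⟩ : ∃ e : Fin (redRank φ f) → RedModule φ f, IsTorsionBasis h.1 e := by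
    unfold RedModule
    rw [redOp_eq]
    exact exists_isTorsionBasis h.2.2 hrank hh
  exact ⟨redRank φ f, exists_basis_charpoly_tateMap_eq hdiv he (frobEnd φ f) _
    fun k _ _ hE hG n => dvd_coeff_charpoly_sub_frobCharpoly φ (h.2.1.pow k)
      (fun hdvd => not_dvd_of_ne hne (f.2.2.prime.dvd_of_dvd_pow hdvd)) hE hG n⟩

variable {φ} in
theorem IsFrobCharpoly.unique {h : MonicIrred F} {P P' : F[X][X]} (hP : IsFrobCharpoly φ f h P)
    (hP' : IsFrobCharpoly φ f h P') : P = P' := by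
  obtain ⟨m, b, hb⟩ := hP
  obtain ⟨m', b', hb'⟩ := hP'
  have hcharpoly := charpoly_toMatrix_eq (R := AdicCompletion (Ideal.span {h.1}) F[X])
    (M := tateModule (RedModule φ f) h.1) b b' (tateMap h.1 (frobEnd φ f))
  exact map_injective _ (algebraMap_adicCompletion_injective h.2.2.not_isUnit)
    (hb.symm.trans (hcharpoly.trans hb'))

variable (f)

theorem frobPoly_eq : frobPoly φ f = frobCharpoly φ f := by
  have hexists : ∃ P : F[X][X], ∀ h : MonicIrred F, h ≠ f → IsFrobCharpoly φ f h P :=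
    ⟨_, fun _ => isFrobCharpoly_frobCharpoly φ⟩
  obtain ⟨h, hh⟩ := exists_monicIrred_ne f
  rw [frobPoly, dif_pos hexists]
  exact (hexists.choose_spec h hh).unique (isFrobCharpoly_frobCharpoly φ hh)

theorem eulerPoly_eq : eulerPoly φ f = 1 + ∑ i ∈ Finset.Icc 1 (redRank φ f),
    C ((localPoly φ f).coeff i * f.1 ^ (i - 1)) * X ^ i := by
  obtain ⟨a, ha, -, hdeg, hloc⟩ := frobCharpoly_spec φ f
  rw [eulerPoly, frobPoly_eq, hdeg]
  congr 1
  refine Finset.sum_congr rfl fun i hi => ?_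
  have hpos : 0 < redRank φ f := by
    have hi_mem := Finset.mem_Icc.mp hi
    omega
  have hconst : frobConst φ f = a⁻¹ := by
    rw [frobConst, frobPoly_eq, hloc hpos, coeff_C_mul, localPoly_coeff_zero, leadingCoeff_mul,
      leadingCoeff_C, f.2.1.leadingCoeff, mul_one]
  rw [hconst, hloc hpos, coeff_C_mul, ← mul_assoc (C a⁻¹), ← C_mul, inv_mul_cancel₀ ha, C_1,
    one_mul]

theorem coeff_eulerPoly_zero : (eulerPoly φ f).coeff 0 = 1 := by
  rw [eulerPoly_eq, coeff_add, coeff_one_zero, finsetSum_coeff, Finset.sum_eq_zero, add_zero]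
  intro i hi
  have hi_mem := Finset.mem_Icc.mp hi
  rw [coeff_C_mul_X_pow, if_neg (by omega)]

theorem coeff_eulerPoly_of_pos {i : ℕ} (hi : 0 < i) :
    (eulerPoly φ f).coeff i = (localPoly φ f).coeff i * f.1 ^ (i - 1) := by
  rw [eulerPoly_eq, coeff_add, coeff_one, if_neg hi.ne', zero_add, finsetSum_coeff]
  simp only [coeff_C_mul_X_pow]
  rw [Finset.sum_ite_eq]
  split_ifs with h
  · rfl
  · rw [coeff_eq_zero_of_natDegree_lt, zero_mul]
    rw [natDegree_localPoly]
    rw [Finset.mem_Icc] at h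
    omega

end FrobPoly

/-! ### The action of `ψ_θ` on the quotient by `f` -/

section PsiCharpoly

variable {F : Type*} [Field F] (n : ℕ) (φ : DrinfeldModule F) (f : MonicIrred F)

/-- The element `t ^ deg a * a(z₁) ⋯ a(z_n)`. -/
def evalProd (a : F[X]) : BaseField F n :=
  (∏ j : Fin n, aeval (zVar F n j) a) * tVar F n ^ a.natDegree

theorem aeval_zVar_ne_zero {a : F[X]} (ha : a ≠ 0) (j : Fin n) : aeval (zVar F n j) a ≠ 0 := by
  have htrans : Transcendental F (zVar F n j) :=
    (transcendental_algebraMap_iff (IsFractionRing.injective _ _)).mpr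
      (MvPolynomial.transcendental_X F (Sum.inl j))
  exact fun h0 => htrans ⟨a, ha, h0⟩

theorem tVar_ne_zero : tVar F n ≠ 0 := by
  rw [tVar, Ne, FaithfulSMul.algebraMap_eq_zero_iff]
  exact MvPolynomial.X_ne_zero _

theorem evalProd_ne_zero {a : F[X]} (ha : a ≠ 0) : evalProd n a ≠ 0 :=
  mul_ne_zero (Finset.prod_ne_zero_iff.mpr fun j _ => aeval_zVar_ne_zero n ha j)
    (pow_ne_zero _ (tVar_ne_zero n))

theorem exists_pow_basis : ∃ b : Module.Basis (Fin f.1.natDegree) (BaseField F n) (PrimeQuot n f),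
    ∀ l, b l = Ideal.Quotient.mk _ (X ^ (l : ℕ)) := by
  have hmonic := f.2.1.map (algebraMap F (BaseField F n))
  have hdim : (AdjoinRoot.powerBasis' hmonic).dim = f.1.natDegree := by
    rw [AdjoinRoot.powerBasis'_dim, natDegree_map]
  let e : AdjoinRoot (baseChange n f.1) ≃ₗ[BaseField F n] PrimeQuot n f :=
    { toFun := id, invFun := id, map_add' := fun _ _ => rfl, map_smul' := fun _ _ => rfl }
  refine ⟨((AdjoinRoot.powerBasis' hmonic).basis.reindex (finCongr hdim)).map e, fun l => ?_⟩
  rw [Module.Basis.map_apply, Module.Basis.reindex_apply, PowerBasis.basis_eq_pow,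
    AdjoinRoot.powerBasis'_gen]
  rfl

theorem fittingGen_primeQuot : fittingGen (BaseField F n) (PrimeQuot n f) = baseChange n f.1 := by
  obtain ⟨b, -⟩ := exists_pow_basis n f
  refine eq_of_monic_of_dvd_of_natDegree_le (f.2.1.map _) (LinearMap.charpoly_monic _) ?_ ?_
  · have hCH := LinearMap.aeval_self_charpoly
      (Algebra.lsmul (BaseField F n) (BaseField F n) (PrimeQuot n f) (X : (BaseField F n)[X]))
    rw [aeval_algHom_apply, aeval_X_left_apply] at hCH
    have hmk : ∀ p : (BaseField F n)[X],
        Ideal.Quotient.mk (primeIdeal n f) p = p • (1 : PrimeQuot n f) :=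
      fun p => (congrArg (Ideal.Quotient.mk (primeIdeal n f)) (mul_one p)).symm
    rw [← Ideal.mem_span_singleton, ← Ideal.Quotient.eq_zero_iff_mem]
    exact (hmk _).trans (LinearMap.congr_fun hCH 1)
  · rw [fittingGen, LinearMap.charpoly_natDegree, natDegree_map,
      Module.finrank_eq_card_basis b, Fintype.card_fin]

/-- An algebraic closure of `𝔽_q(z₁, …, z_n, t)`. -/
abbrev BaseClosure (F : Type*) [Field F] (n : ℕ) := AlgebraicClosure (BaseField F n)

/-- An embedding of `A / f A` in an algebraic closure of `𝔽_q(z₁, …, z_n, t)`. -/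
def resEmb : AdjoinRoot f.1 →ₐ[F] BaseClosure F n :=
  have : Module.Finite F (AdjoinRoot f.1) := f.2.1.finite_adjoinRoot
  IsAlgClosed.lift

variable [Fintype F]

/-- The conjugates `ϑ ^ (q ^ i)` of the root `ϑ` of `f` which is the image of `θ`. -/
def conjRoot (i : ℕ) : BaseClosure F n :=
  resEmb n f (AdjoinRoot.root f.1 ^ Fintype.card F ^ i)

theorem conjRoot_add_natDegree (i : ℕ) : conjRoot n f (i + f.1.natDegree) = conjRoot n f i := by
  rw [conjRoot, conjRoot, pow_add, mul_comm, pow_mul, pow_card_pow]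

theorem conjRoot_pow (i j : ℕ) : conjRoot n f i ^ Fintype.card F ^ j = conjRoot n f (i + j) := by
  rw [conjRoot, conjRoot, ← map_pow, ← pow_mul, ← pow_add]

theorem conjRoot_injective :
    Function.Injective fun j : Fin f.1.natDegree => conjRoot n f j :=
  (resEmb n f).injective.comp (root_pow_card_pow_injective f)

theorem aeval_conjRoot (i : ℕ) (a : F[X]) :
    aeval (conjRoot n f i) a = resEmb n f (AdjoinRoot.mk f.1 a) ^ Fintype.card F ^ i := by
  rw [conjRoot, aeval_algHom_apply, aeval_pow_card_pow, AdjoinRoot.aeval_eq, map_pow]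

theorem prod_sub_conjRoot (z : BaseField F n) :
    ∏ i ∈ Finset.range f.1.natDegree, (algebraMap _ (BaseClosure F n) z - conjRoot n f i) =
      algebraMap _ (BaseClosure F n) (aeval z f.1) := by
  have hprod := congrArg (fun p => aeval (algebraMap _ (BaseClosure F n) z)
    (p.map (resEmb n f : AdjoinRoot f.1 →+* BaseClosure F n))) (prod_X_sub_C_root_pow f)
  simp only [Polynomial.map_prod, Polynomial.map_sub, map_X, map_C, map_prod, map_sub, aeval_X,
    aeval_C, map_map, AlgHom.comp_algebraMap, Algebra.algebraMap_self, RingHom.id_apply,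
    RingHom.coe_coe, aeval_map_algebraMap, aeval_algebraMap_apply] at hprod
  rw [Finset.prod_range]
  exact hprod

/-- The product `t ^ i ℓ_i(z₁) ⋯ ℓ_i(z_n)` evaluated at the root of `f`. -/
def weight (i : ℕ) : BaseClosure F n :=
  algebraMap _ _ (tVar F n) ^ i * ∏ j : Fin n, ∏ l ∈ Finset.range i,
    (algebraMap _ (BaseClosure F n) (zVar F n j) - conjRoot n f l)

theorem weight_add (i m : ℕ) : weight n f (i + m) = weight n f i *
    (algebraMap _ _ (tVar F n) ^ m * ∏ j : Fin n, ∏ l ∈ Finset.range m,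
      (algebraMap _ (BaseClosure F n) (zVar F n j) - conjRoot n f (i + l))) := by
  simp only [weight, Finset.prod_range_add, Finset.prod_mul_distrib, pow_add]
  ring

theorem weight_natDegree : weight n f f.1.natDegree = algebraMap _ _ (evalProd n f.1) := by
  simp only [weight, prod_sub_conjRoot, evalProd, map_mul, map_prod, map_pow]
  ring

theorem weight_add_natDegree (i : ℕ) :
    weight n f (i + f.1.natDegree) = algebraMap _ _ (evalProd n f.1) * weight n f i := by
  rw [add_comm, weight_add, weight_natDegree]
  congr 1
  simp only [add_comm f.1.natDegree, conjRoot_add_natDegree]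
  rfl

theorem weight_ne_zero {i : ℕ} (hi : i ≤ f.1.natDegree) : weight n f i ≠ 0 := by
  obtain ⟨m, hm⟩ := Nat.exists_eq_add_of_le hi
  have hprod := weight_natDegree n f
  rw [hm, weight_add] at hprod
  intro h0
  rw [h0, zero_mul] at hprod
  exact evalProd_ne_zero n f.2.1.ne_zero ((map_eq_zero _).mp hprod.symm)

/-- Evaluation at the conjugate `ϑ ^ (q ^ i)` of the root `ϑ` of `f`. -/
def evConj (i : ℕ) : PrimeQuot n f →ₐ[BaseField F n] BaseClosure F n :=
  Ideal.Quotient.liftₐ _ (aeval (conjRoot n f i)) (by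
    intro a ha
    obtain ⟨b, rfl⟩ := Ideal.mem_span_singleton.mp ha
    rw [map_mul, aeval_map_algebraMap, aeval_conjRoot, AdjoinRoot.mk_self, map_zero,
      zero_pow (pow_pos Fintype.card_pos _).ne', zero_mul])

theorem evConj_mk (i : ℕ) (p : (BaseField F n)[X]) :
    evConj n f i (Ideal.Quotient.mk _ p) = aeval (conjRoot n f i) p := rfl

theorem evConj_quotFrob (i : ℕ) (w : PrimeQuot n f) :
    evConj n f i (quotFrob n f w) = evConj n f (i + 1) w := by
  obtain ⟨p, rfl⟩ := Ideal.Quotient.mk_surjective w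
  rw [quotFrob, Ideal.quotient_map_mkₐ, Ideal.Quotient.mkₐ_eq_mk, evConj_mk, evConj_mk,
    expand_aeval, ← conjRoot_pow, pow_one]

theorem evConj_quotFrob_pow (i m : ℕ) (w : PrimeQuot n f) :
    evConj n f i (((quotFrob n f).toLinearMap ^ m) w) = evConj n f (i + m) w := by
  induction m generalizing i with
  | zero => simp
  | succ m ih =>
    rw [pow_succ', Module.End.mul_apply, AlgHom.toLinearMap_apply, evConj_quotFrob, ih, add_assoc,
      add_comm 1]

theorem aeval_psiCoeff (j i : ℕ) : weight n f j * aeval (conjRoot n f j) (psiCoeff n φ i) =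
    resEmb n f (redCoeff φ f i) ^ Fintype.card F ^ j * weight n f (j + i) := by
  have hell : ∀ l : Fin n, aeval (conjRoot n f j) (ell n i (zVar F n l)) =
      ∏ m ∈ Finset.range i,
        (algebraMap _ (BaseClosure F n) (zVar F n l) - conjRoot n f (j + m)) := fun l => by
    simp [ell, map_prod, conjRoot_pow]
  rw [weight_add, psiCoeff, map_mul, map_mul, aeval_C, aeval_map_algebraMap, aeval_conjRoot,
    redCoeff, map_prod]
  simp only [hell, map_pow]
  ring

/-- Evaluation at the conjugate `ϑ ^ (q ^ i)` multiplied by `weight n f i`. With this weight the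
polynomials `ℓ_i` disappear from the action of `ψ_θ`. -/
def evWeight (i : ℕ) : PrimeQuot n f →ₗ[BaseField F n] BaseClosure F n :=
  weight n f i • (evConj n f i).toLinearMap

theorem evWeight_apply (i : ℕ) (w : PrimeQuot n f) :
    evWeight n f i w = weight n f i * evConj n f i w := rfl

theorem evWeight_psiOp (j : ℕ) (w : PrimeQuot n f) : evWeight n f j (psiOp n φ f w) =
    ∑ i ∈ Finset.range (φ.rank + 1),
      resEmb n f (redCoeff φ f i) ^ Fintype.card F ^ j • evWeight n f (j + i) w := by
  simp only [psiOp, skewOp, LinearMap.sum_apply, evWeight_apply, map_sum,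
    Module.End.mul_apply, LinearMap.mulLeft_apply, map_mul, evConj_quotFrob_pow, evConj_mk]
  refine Finset.sum_congr rfl fun i _ => ?_
  rw [← mul_assoc, aeval_psiCoeff, smul_eq_mul, mul_assoc]

theorem evConj_add_natDegree (j : ℕ) (w : PrimeQuot n f) :
    evConj n f (j + f.1.natDegree) w = evConj n f j w := by
  obtain ⟨p, rfl⟩ := Ideal.Quotient.mk_surjective w
  rw [evConj_mk, evConj_mk, conjRoot_add_natDegree]

theorem evWeight_add_natDegree (j : ℕ) (w : PrimeQuot n f) :
    evWeight n f (j + f.1.natDegree) w =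
      algebraMap _ (BaseClosure F n) (evalProd n f.1) • evWeight n f j w := by
  rw [evWeight_apply, evWeight_apply, evConj_add_natDegree, weight_add_natDegree, smul_eq_mul,
    mul_assoc]

theorem det_evWeight_pow_ne_zero :
    (Matrix.of fun j l : Fin f.1.natDegree =>
      evWeight n f j (Ideal.Quotient.mk _ (X ^ (l : ℕ)))).det ≠ 0 := by
  have hfactor : (Matrix.of fun j l : Fin f.1.natDegree =>
      evWeight n f j (Ideal.Quotient.mk _ (X ^ (l : ℕ)))) =
      Matrix.diagonal (fun j : Fin f.1.natDegree => weight n f j) *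
        Matrix.vandermonde fun j => conjRoot n f j := by
    ext j l
    rw [Matrix.of_apply, evWeight_apply, evConj_mk, map_pow, aeval_X, Matrix.diagonal_mul,
      Matrix.vandermonde_apply]
  rw [hfactor, Matrix.det_mul, Matrix.det_diagonal]
  exact mul_ne_zero (Finset.prod_ne_zero_iff.mpr fun j _ => weight_ne_zero n f j.2.le)
    (Matrix.det_vandermonde_ne_zero_iff.mpr (conjRoot_injective n f))

theorem map_charpoly_psiOp : (psiOp n φ f).charpoly.map (algebraMap _ (BaseClosure F n)) =
    twistDet (Fintype.card F) f.1.natDegree φ.rank (fun i => C (resEmb n f (redCoeff φ f i))) X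
      (C (algebraMap _ (BaseClosure F n) (evalProd n f.1))) := by
  obtain ⟨b, hb⟩ := exists_pow_basis n f
  rw [← charpoly_twistMatrix]
  refine charpoly_map_eq_of_apply_eq_sum b (l := fun j : Fin f.1.natDegree => evWeight n f j)
    ?_ fun j w => ?_
  · simpa only [hb] using det_evWeight_pow_ne_zero n f
  · rw [evWeight_psiOp]
    exact (twistMatrix_smul (v := fun m => evWeight n f m w) (natDegree_pos f)
      (fun m => evWeight_add_natDegree n f m w) _ _ _ j).symm

theorem charpoly_psiOp : (psiOp n φ f).charpoly =
    ((localPoly φ f).map (mapRingHom (algebraMap F (BaseField F n)))).eval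
      (C (evalProd n f.1)) := by
  apply map_injective _ (algebraMap (BaseField F n) (BaseClosure F n)).injective
  have hlocal := congrArg
    (eval₂RingHom (mapRingHom (resEmb n f : AdjoinRoot f.1 →+* BaseClosure F n))
      (C (algebraMap _ (BaseClosure F n) (evalProd n f.1)))) (map_localPoly φ f)
  rw [twistPoly, map_twistDet] at hlocal
  simp only [coe_eval₂RingHom, eval₂_C, eval₂_X, coe_mapRingHom, map_C, map_X, RingHom.coe_coe,
    eval₂_map, mapRingHom_comp, AlgHom.comp_algebraMap] at hlocal
  rw [map_charpoly_psiOp, ← hlocal, eval_map, ← coe_mapRingHom, hom_eval₂, coe_mapRingHom, map_C,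
    mapRingHom_comp, ← IsScalarTower.algebraMap_eq]

theorem fittingGen_psiModule : fittingGen (BaseField F n) (PsiModule n φ f) =
    ((localPoly φ f).map (mapRingHom (algebraMap F (BaseField F n)))).eval
      (C (evalProd n f.1)) := by
  rw [← charpoly_psiOp, fittingGen,
    ← LinearEquiv.charpoly_conj (Module.AEval'.of (psiOp n φ f)) (psiOp n φ f)]
  congr 1
  refine LinearMap.ext fun w => ?_
  obtain ⟨w, rfl⟩ := (Module.AEval'.of (psiOp n φ f)).surjective w
  rw [LinearEquiv.conj_apply_apply, LinearEquiv.symm_apply_apply]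
  exact Module.AEval'.X_smul_of _ w

end PsiCharpoly

section EulerProduct

open Filter Topology

variable {ι R : Type*}

theorem prod_add_single [CommMonoid R] {g : ι → ℕ → R} (hg : ∀ i, g i 0 = 1) {s : Finset ι} {i : ι}
    (hi : i ∉ s) (j : ℕ) {m : ι →₀ ℕ} (hm : m.support ⊆ s) :
    (Finsupp.single i j + m).prod g = g i j * m.prod g := by
  classical
  rw [Finsupp.prod_add_index_of_disjoint, Finsupp.prod_single_index (hg i)]
  exact Finset.disjoint_of_subset_left Finsupp.support_single_subset
    (Finset.disjoint_singleton_left.mpr fun h => hi (hm h))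

/-- A finitely supported exponent vector on `insert i s` is an exponent at `i` together with an
exponent vector on `s`. -/
def insertEquiv [DecidableEq ι] {s : Finset ι} {i : ι} (hi : i ∉ s) :
    ℕ × {m : ι →₀ ℕ // m.support ⊆ s} ≃ {m : ι →₀ ℕ // m.support ⊆ insert i s} where
  toFun p := ⟨Finsupp.single i p.1 + p.2.1, Finsupp.support_add.trans
    (Finset.union_subset (Finsupp.support_single_subset.trans (by simp))
      (p.2.2.trans (Finset.subset_insert i s)))⟩
  invFun m := ⟨m.1 i, m.1.erase i, by
    rw [Finsupp.support_erase, ← Finset.subset_insert_iff]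
    exact m.2⟩
  left_inv := by
    rintro ⟨j, m, hm⟩
    have hmi : i ∉ m.support := fun h => hi (hm h)
    refine Prod.ext (by simp [Finsupp.notMem_support_iff.mp hmi]) (Subtype.ext ?_)
    simp [Finsupp.erase_add, Finsupp.erase_single, Finsupp.erase_of_notMem_support hmi]
  right_inv m := Subtype.ext (Finsupp.single_add_erase i m.1)

variable [CommRing R] [UniformSpace R] [IsUniformAddGroup R] [NonarchimedeanRing R]

theorem hasSum_prod_of_support_subset {g : ι → ℕ → R} (hg : ∀ i, g i 0 = 1) {a : ι → R}
    (ha : ∀ i, HasSum (g i) (a i)) (s : Finset ι) :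
    HasSum (fun m : {m : ι →₀ ℕ // m.support ⊆ s} => m.1.prod g) (∏ i ∈ s, a i) := by
  classical
  induction s using Finset.induction_on with
  | empty =>
    have eq_zero : ∀ m : {m : ι →₀ ℕ // m.support ⊆ ∅}, m = ⟨0, by simp⟩ := fun m =>
      Subtype.ext (Finsupp.support_eq_empty.mp (Finset.subset_empty.mp m.2))
    rw [Finset.prod_empty]
    exact hasSum_single (⟨0, by simp⟩ : {m : ι →₀ ℕ // m.support ⊆ ∅})
      fun m hm => (hm (eq_zero m)).elim
  | insert i s hi ih =>
    rw [Finset.prod_insert hi, ← (insertEquiv hi).hasSum_iff]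
    refine ((ha i).mul_of_nonarchimedean ih).congr_fun ?_
    exact fun p => prod_add_single hg hi p.1 p.2.2

theorem tsum_mul_tsum_eq_one [T2Space R] {b e : ℕ → R} (hb : Summable b) (he : Summable e)
    (hbe : ∀ m, ∑ p ∈ Finset.HasAntidiagonal.antidiagonal m, b p.1 * e p.2 =
      if m = 0 then 1 else 0) :
    (∑' i, b i) * ∑' i, e i = 1 := by
  rw [hb.tsum_mul_tsum_eq_tsum_sum_antidiagonal he (hb.mul_of_nonarchimedean he)]
  simp_rw [hbe]
  exact tsum_ite_eq 0 1

theorem hasProd_of_hasSum_finsupp_prod {g : ι → ℕ → R} (hg : ∀ i, g i 0 = 1) {a : ι → R}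
    (ha : ∀ i, HasSum (g i) (a i)) {S : R} (hS : HasSum (fun m : ι →₀ ℕ => m.prod g) S) :
    HasProd a S := by
  classical
  rw [HasProd, SummationFilter.unconditional_filter]
  rw [HasSum, SummationFilter.unconditional_filter] at hS
  refine (closed_nhds_basis S).tendsto_right_iff.mpr fun U hU => ?_
  obtain ⟨T, hT⟩ := eventually_atTop.mp (hS.eventually_mem hU.1)
  refine eventually_atTop.mpr ⟨T.biUnion Finsupp.support, fun s hs => ?_⟩
  -- The partial product over `s` is a limit of partial sums over supersets of `T`.
  have hprod := hasSum_prod_of_support_subset hg ha s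
  rw [HasSum, SummationFilter.unconditional_filter] at hprod
  refine hU.2.mem_of_tendsto hprod (eventually_atTop.mpr
    ⟨T.subtype fun m => m.support ⊆ s, fun T' hT' => ?_⟩)
  simpa using hT (T'.map (Function.Embedding.subtype _)) fun m hm =>
    Finset.mem_map.mpr ⟨⟨m, (Finset.subset_biUnion_of_mem _ hm).trans hs⟩,
      hT' (Finset.mem_subtype.mpr hm), rfl⟩

end EulerProduct

/-! ### The valuation on Laurent series -/

section Laurent

open Filter Topology WithZero

variable {k : Type*} [Field k]

instance : NonarchimedeanRing (LaurentSeries k) :=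
  (Valued.v (R := LaurentSeries k)).subgroups_basis.nonarchimedean

theorem tendsto_zero_of_valuation_le {α : Type*} {l : Filter α} {g : α → LaurentSeries k}
    (hg : ∀ N : ℕ, ∀ᶠ a in l, Valued.v (g a) ≤ exp (-(N : ℤ))) : Tendsto g l (𝓝 0) := by
  refine (Valued.hasBasis_nhds_zero (LaurentSeries k) ℤᵐ⁰).tendsto_right_iff.mpr fun γ _ => ?_
  have hγ : MonoidWithZeroHom.ValueGroup₀.embedding γ.1 ≠ (0 : ℤᵐ⁰) := by
    rw [Ne, map_eq_zero]
    exact γ.ne_zero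
  obtain ⟨c, hc⟩ : ∃ c : ℤ, MonoidWithZeroHom.ValueGroup₀.embedding γ.1 = exp c :=
    ⟨_, (exp_log hγ).symm⟩
  filter_upwards [hg (1 - c).toNat] with a ha
  rw [Valued.v.restrict_lt_iff_lt_embedding, hc]
  refine ha.trans_lt (exp_lt_exp.mpr ?_)
  lia

theorem valuation_toLaurent_C_le (c : k) : Valued.v (toLaurent k (C c)) ≤ 1 := by
  rw [← exp_zero, ← neg_zero, LaurentSeries.valuation_le_iff_coeff_lt_eq_zero]
  intro m hm
  rw [toLaurent, aeval_C, LaurentSeries.algebraMap_apply, HahnSeries.C_apply,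
    HahnSeries.coeff_single_of_ne hm.ne]

theorem valuation_toLaurent_C {c : k} (hc : c ≠ 0) : Valued.v (toLaurent k (C c)) = 1 := by
  have hmul : Valued.v (toLaurent k (C c)) * Valued.v (toLaurent k (C c⁻¹)) = 1 := by
    rw [← map_mul, ← map_mul, ← C_mul, mul_inv_cancel₀ hc, C_1, map_one, map_one]
  refine (valuation_toLaurent_C_le c).antisymm ?_
  calc 1 = Valued.v (toLaurent k (C c)) * Valued.v (toLaurent k (C c⁻¹)) := hmul.symm
    _ ≤ Valued.v (toLaurent k (C c)) := mul_le_of_le_one_right' (valuation_toLaurent_C_le c⁻¹)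

theorem valuation_toLaurent_X_pow (i : ℕ) : Valued.v (toLaurent k (X ^ i)) = exp (i : ℤ) := by
  rw [map_pow, map_pow, toLaurent, aeval_X, LaurentSeries.valuation_single_zpow, neg_neg,
    ← exp_nsmul, nsmul_one]

theorem valuation_toLaurent_le (p : k[X]) :
    Valued.v (toLaurent k p) ≤ exp (p.natDegree : ℤ) := by
  nth_rw 1 [p.as_sum_range_C_mul_X_pow]
  rw [map_sum]
  refine Valuation.map_sum_le _ fun i hi => ?_
  rw [map_mul, map_mul, valuation_toLaurent_X_pow]
  refine (mul_le_of_le_one_left' (valuation_toLaurent_C_le _)).trans (exp_le_exp.mpr ?_)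
  exact_mod_cast Nat.lt_succ_iff.mp (Finset.mem_range.mp hi)

theorem valuation_toLaurent {p : k[X]} (hp : p ≠ 0) :
    Valued.v (toLaurent k p) = exp (p.natDegree : ℤ) := by
  have hlead : Valued.v (toLaurent k (C p.leadingCoeff * X ^ p.natDegree)) =
      exp (p.natDegree : ℤ) := by
    rw [map_mul, map_mul, valuation_toLaurent_X_pow,
      valuation_toLaurent_C (leadingCoeff_ne_zero.mpr hp), one_mul]
  nth_rw 1 [← p.eraseLead_add_C_mul_X_pow]
  rw [map_add, Valuation.map_add_eq_of_lt_right, hlead]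
  rw [hlead]
  rcases p.eraseLead_natDegree_lt_or_eraseLead_eq_zero with hlt | hzero
  · exact (valuation_toLaurent_le _).trans_lt (exp_lt_exp.mpr (by exact_mod_cast hlt))
  · rw [hzero, map_zero, map_zero]
    exact exp_pos

theorem toLaurent_injective : Function.Injective (toLaurent k) :=
  (injective_iff_map_eq_zero _).mpr fun p hp => by
    by_contra hp0
    have hval := valuation_toLaurent hp0
    rw [hp, map_zero] at hval
    exact exp_ne_zero hval.symm

end Laurent

/-! ### The expansion of the Euler product -/

section Factorization

variable {F : Type*} [Field F]

/-- The monic polynomial with a given factorization. -/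
def factorProd (m : MonicIrred F →₀ ℕ) : MonicPoly F :=
  ⟨m.prod fun f i => f.1 ^ i, monic_prod_of_monic _ _ fun f _ => f.2.1.pow _⟩

theorem multiplicity_factorProd (m : MonicIrred F →₀ ℕ) (f : MonicIrred F) :
    multiplicity f.1 (factorProd m).1 = m f := by
  classical
  have hsplit : (factorProd m).1 = f.1 ^ m f * (m.erase f).prod fun g i => g.1 ^ i :=
    (Finsupp.mul_prod_erase' m f _ fun _ => pow_zero _).symm
  have hndvd : ¬ f.1 ∣ (m.erase f).prod fun g i => g.1 ^ i := by
    intro hdvd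
    obtain ⟨g, hg, hfg⟩ := (Prime.dvd_finsetProd_iff f.2.2.prime _).mp hdvd
    rw [Finsupp.support_erase] at hg
    refine Finset.ne_of_mem_erase hg (Subtype.ext ?_)
    exact (eq_of_monic_of_associated f.2.1 g.2.1
      ((f.2.2.dvd_irreducible_iff_associated g.2.2).mp (f.2.2.prime.dvd_of_dvd_pow hfg))).symm
  refine multiplicity_eq_of_dvd_of_not_dvd (hsplit ▸ dvd_mul_right _ _) fun hdvd => hndvd ?_
  rw [hsplit, pow_succ] at hdvd
  exact (mul_dvd_mul_iff_left (pow_ne_zero _ f.2.1.ne_zero)).mp hdvd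

theorem factorProd_single_one_add (f : MonicIrred F) (m : MonicIrred F →₀ ℕ) :
    (factorProd (Finsupp.single f 1 + m)).1 = f.1 * (factorProd m).1 := by
  classical
  change Finsupp.prod _ (fun (g : MonicIrred F) i => g.1 ^ i) = _
  rw [Finsupp.prod_add_index' (h := fun (g : MonicIrred F) i => g.1 ^ i)
    (fun _ => pow_zero _) fun _ _ _ => pow_add _ _ _,
    Finsupp.prod_single_index (h := fun (g : MonicIrred F) i => g.1 ^ i) (pow_zero _), pow_one]
  rfl

theorem factorProd_surjective : Function.Surjective (factorProd (F := F)) := by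
  rintro ⟨a, ha⟩
  induction hdeg : a.natDegree using Nat.strong_induction_on generalizing a with
  | _ d ih =>
    rcases Nat.eq_zero_or_pos d with rfl | hpos
    · exact ⟨0, Subtype.ext (by
        simpa [factorProd] using (eq_one_of_monic_natDegree_zero ha hdeg).symm)⟩
    · have hunit : ¬ IsUnit a := fun h => by
        rw [natDegree_eq_zero_of_isUnit h] at hdeg
        exact hpos.ne hdeg
      obtain ⟨f, hf, hirr, b, rfl⟩ := exists_monic_irreducible_factor a hunit
      have hb : b.Monic := hf.of_mul_monic_left ha
      have hfpos := hirr.natDegree_pos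
      rw [hf.natDegree_mul hb] at hdeg
      obtain ⟨m, hm⟩ := ih b.natDegree (by lia) b hb rfl
      refine ⟨Finsupp.single ⟨f, hf, hirr⟩ 1 + m, Subtype.ext ?_⟩
      rw [factorProd_single_one_add, hm]

/-- Unique factorization of monic polynomials. -/
def factorEquiv : (MonicIrred F →₀ ℕ) ≃ MonicPoly F :=
  Equiv.ofBijective factorProd ⟨fun m m' h => Finsupp.ext fun f => by
    rw [← multiplicity_factorProd, h, multiplicity_factorProd], factorProd_surjective⟩

theorem finite_natDegree_lt [Finite F] (D : ℕ) : {a : MonicPoly F | a.1.natDegree < D}.Finite := by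
  have : Finite (degreeLT F D) := Module.finite_of_finite F
  refine Set.Finite.of_finite_image (f := Subtype.val)
    ((Set.toFinite (degreeLT F D : Set F[X])).subset ?_) Subtype.val_injective.injOn
  rintro _ ⟨a, ha, rfl⟩
  rw [SetLike.mem_coe, mem_degreeLT]
  exact (natDegree_lt_iff_degree_lt a.2.ne_zero).mp ha

variable (n : ℕ)

theorem evalProd_one : evalProd n (1 : F[X]) = 1 := by simp [evalProd]

theorem evalProd_mul {a b : F[X]} (ha : a ≠ 0) (hb : b ≠ 0) :
    evalProd n (a * b) = evalProd n a * evalProd n b := by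
  simp only [evalProd, map_mul, Finset.prod_mul_distrib, natDegree_mul ha hb, pow_add]
  ring

theorem evalProd_pow {a : F[X]} (ha : a ≠ 0) (i : ℕ) : evalProd n (a ^ i) = evalProd n a ^ i := by
  induction i with
  | zero => rw [pow_zero, pow_zero, evalProd_one]
  | succ i ih => rw [pow_succ, pow_succ, evalProd_mul n (pow_ne_zero i ha) ha, ih]

theorem evalProd_factorProd (m : MonicIrred F →₀ ℕ) :
    evalProd n (factorProd m).1 = m.prod fun f i => evalProd n f.1 ^ i := by
  classical
  simp only [factorProd, Finsupp.prod]
  induction m.support using Finset.induction_on with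
  | empty => simp [evalProd_one]
  | insert f s hf ih =>
    rw [Finset.prod_insert hf, Finset.prod_insert hf, evalProd_mul n
      (pow_ne_zero _ f.2.1.ne_zero)
      (Finset.prod_ne_zero_iff.mpr fun g _ => pow_ne_zero _ g.2.1.ne_zero), ih,
      evalProd_pow n f.2.1.ne_zero]

theorem toLaurent_baseChange_ne_zero (f : MonicIrred F) :
    toLaurent _ (baseChange n f.1) ≠ 0 :=
  (map_ne_zero_iff _ toLaurent_injective).mpr (f.2.1.map _).ne_zero

end Factorization

section Expansion

theorem mul_pow_sub_one_mul_div {K : Type*} [Field K] {x : K} (hx : x ≠ 0) (a c : K) {i : ℕ}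
    (hi : 0 < i) : a * x ^ (i - 1) * (c ^ i / x ^ i) = a * c ^ i / x := by
  rw [mul_div_assoc', div_eq_div_iff (pow_ne_zero i hx) hx, ← pow_sub_one_mul hi.ne' x]
  ring

variable {F : Type*} [Field F] [Fintype F] (n : ℕ) (φ : DrinfeldModule F)

theorem coeff_zero_eulerSeries (f : MonicIrred F) :
    PowerSeries.coeff 0 (eulerSeries φ f) = 1 := by
  rw [eulerSeries, PowerSeries.coeff_zero_eq_constantCoeff, PowerSeries.constantCoeff_invOfUnit,
    inv_one, Units.val_one]

theorem eulerPoly_mul_eulerSeries (f : MonicIrred F) :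
    (eulerPoly φ f : PowerSeries F[X]) * eulerSeries φ f = 1 := by
  refine PowerSeries.mul_invOfUnit _ 1 ?_
  rw [← PowerSeries.coeff_zero_eq_constantCoeff, Polynomial.coeff_coe, coeff_eulerPoly_zero,
    Units.val_one]

theorem mu_factorProd (m : MonicIrred F →₀ ℕ) :
    mu φ (factorProd m) = m.prod fun f i => PowerSeries.coeff i (eulerSeries φ f) := by
  rw [mu]
  simp_rw [multiplicity_factorProd]
  refine finprod_eq_prod_of_mulSupport_subset _ fun f hf => ?_
  rw [Finset.mem_coe, Finsupp.mem_support_iff]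
  intro hmf
  refine hf ?_
  beta_reduce
  rw [hmf, coeff_zero_eulerSeries]

theorem rank_mul_natDegree_coeff_eulerPoly_le (f : MonicIrred F) (i : ℕ) :
    φ.rank * ((eulerPoly φ f).coeff i).natDegree ≤ (φ.rank - 1) * (f.1.natDegree * i) := by
  rcases Nat.eq_zero_or_pos i with rfl | hi
  · rw [coeff_eulerPoly_zero, natDegree_one, mul_zero, mul_zero, mul_zero]
  rw [coeff_eulerPoly_of_pos φ f hi]
  by_cases hcoeff : (localPoly φ f).coeff i = 0
  · rw [hcoeff, zero_mul, natDegree_zero, mul_zero]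
    exact zero_le
  have hweight := weight_coeff_localPoly_le φ f hcoeff
  rw [natDegree_mul hcoeff (pow_ne_zero _ f.2.1.ne_zero), natDegree_pow]
  obtain ⟨j, rfl⟩ := Nat.exists_eq_add_of_le' hi
  obtain ⟨s, hs⟩ := Nat.exists_eq_add_of_le' φ.rank_pos
  rw [hs] at hweight ⊢
  simp only [Nat.add_sub_cancel]
  nlinarith

theorem rank_mul_natDegree_coeff_eulerSeries_le (f : MonicIrred F) (i : ℕ) :
    φ.rank * (PowerSeries.coeff i (eulerSeries φ f)).natDegree ≤
      (φ.rank - 1) * (f.1.natDegree * i) := by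
  induction i using Nat.strong_induction_on with
  | _ i ih =>
    rw [mul_comm, ← Nat.le_div_iff_mul_le φ.rank_pos, eulerSeries, PowerSeries.coeff_invOfUnit]
    split_ifs with hi
    · simp
    rw [inv_one, Units.val_one, neg_one_mul, natDegree_neg]
    refine natDegree_sum_le_of_forall_le _ _ fun p hp => ?_
    split_ifs with hlt
    · rw [Nat.le_div_iff_mul_le φ.rank_pos, Polynomial.coeff_coe, mul_comm]
      have hseries := ih p.2 hlt
      rw [eulerSeries] at hseries
      rw [← Finset.HasAntidiagonal.mem_antidiagonal.mp hp]
      refine (Nat.mul_le_mul_left _ natDegree_mul_le).trans ?_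
      rw [mul_add, mul_add, mul_add]
      exact add_le_add (rank_mul_natDegree_coeff_eulerPoly_le φ f p.1) hseries
    · simp

theorem rank_mul_natDegree_mu_le (a : MonicPoly F) :
    φ.rank * (mu φ a).natDegree ≤ (φ.rank - 1) * a.1.natDegree := by
  obtain ⟨m, rfl⟩ := factorProd_surjective a
  rw [mu_factorProd]
  refine (Nat.mul_le_mul_left _ (natDegree_prod_le _ _)).trans ?_
  simp only [factorProd, Finsupp.prod]
  rw [natDegree_prod_of_monic _ _ fun f _ => f.2.1.pow _, Finset.mul_sum, Finset.mul_sum]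
  refine Finset.sum_le_sum fun f _ => ?_
  rw [natDegree_pow, mul_comm (m f)]
  exact rank_mul_natDegree_coeff_eulerSeries_le φ f (m f)

open WithZero in
theorem valuation_seriesTerm_le {N : ℕ} {a : MonicPoly F} (ha : φ.rank * N ≤ a.1.natDegree) :
    Valued.v (seriesTerm n φ a) ≤ exp (-(N : ℤ)) := by
  rw [seriesTerm, ← evalProd, map_div₀, valuation_toLaurent (a.2.map _).ne_zero, map_mul, map_mul,
    valuation_toLaurent_C (evalProd_ne_zero n a.2.ne_zero), mul_one]
  refine (div_le_div_of_nonneg_right (valuation_toLaurent_le _) zero_le).trans ?_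
  rw [← exp_sub, exp_le_exp, natDegree_map, natDegree_map]
  have hmu := rank_mul_natDegree_mu_le φ a
  obtain ⟨s, hs⟩ := Nat.exists_eq_add_of_le' φ.rank_pos
  rw [hs] at hmu ha
  rw [Nat.add_sub_cancel] at hmu
  suffices (mu φ a).natDegree + N ≤ a.1.natDegree by lia
  refine Nat.le_of_mul_le_mul_left (?_ : (s + 1) * _ ≤ (s + 1) * _) s.succ_pos
  nlinarith

theorem summable_seriesTerm : Summable (seriesTerm n φ) := by
  refine NonarchimedeanAddGroup.summable_of_tendsto_cofinite_zero
    (tendsto_zero_of_valuation_le fun N => ?_)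
  refine (finite_natDegree_lt (F := F) (φ.rank * N)).subset fun a ha => ?_
  by_contra hdeg
  exact ha (valuation_seriesTerm_le n φ (not_lt.mp hdeg))

/-- The ratio `t ^ d f(z₁) ⋯ f(z_n) / f`, where `d = deg f`. -/
def evalRatio (f : MonicIrred F) : LaurentSeries (BaseField F n) :=
  toLaurent _ (C (evalProd n f.1)) / toLaurent _ (baseChange n f.1)

/-- The term `μ(f ^ i) x ^ i` of the Euler factor at `f`, where `x = t ^ d f(z₁) ⋯ f(z_n) / f`. -/
def localTerm (f : MonicIrred F) (i : ℕ) : LaurentSeries (BaseField F n) :=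
  toLaurent _ (baseChange n (PowerSeries.coeff i (eulerSeries φ f))) * evalRatio n f ^ i

theorem localTerm_zero (f : MonicIrred F) : localTerm n φ f 0 = 1 := by
  rw [localTerm, coeff_zero_eulerSeries, baseChange, Polynomial.map_one, map_one, pow_zero, mul_one]

theorem seriesTerm_factorProd (m : MonicIrred F →₀ ℕ) :
    seriesTerm n φ (factorProd m) = m.prod (localTerm n φ) := by
  change toLaurent _ (baseChange n (mu φ (factorProd m)) * C (evalProd n (factorProd m).1)) /
    toLaurent _ (baseChange n (factorProd m).1) = _
  rw [mu_factorProd, evalProd_factorProd, factorProd, baseChange, baseChange]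
  simp only [Finsupp.prod, Polynomial.map_prod, map_prod, map_mul]
  rw [← Finset.prod_mul_distrib, ← Finset.prod_div_distrib]
  refine Finset.prod_congr rfl fun f _ => ?_
  rw [localTerm, evalRatio, div_pow, mul_div_assoc, C_pow, map_pow, Polynomial.map_pow, map_pow]

theorem hasSum_eulerPoly (f : MonicIrred F) :
    HasSum (fun i => toLaurent _ (baseChange n ((eulerPoly φ f).coeff i)) * evalRatio n f ^ i)
      (taelmanFactor n φ f)⁻¹ := by
  have hf0 := toLaurent_baseChange_ne_zero n f
  have hterm : ∀ i, toLaurent _ (baseChange n ((eulerPoly φ f).coeff i)) * evalRatio n f ^ i =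
      toLaurent _ (baseChange n ((localPoly φ f).coeff i) * C (evalProd n f.1) ^ i) /
        toLaurent _ (baseChange n f.1) := by
    intro i
    rw [evalRatio, div_pow, map_mul, map_pow]
    rcases Nat.eq_zero_or_pos i with rfl | hi
    · rw [coeff_eulerPoly_zero, localPoly_coeff_zero]
      simp [hf0]
    · rw [coeff_eulerPoly_of_pos φ f hi, baseChange, Polynomial.map_mul, Polynomial.map_pow,
        map_mul, map_pow]
      exact mul_pow_sub_one_mul_div hf0 _ _ hi
  rw [taelmanFactor, inv_div, fittingGen_psiModule, fittingGen_primeQuot, eval_map,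
    eval₂_eq_sum_range, map_sum, Finset.sum_div]
  simp_rw [hterm]
  refine hasSum_sum_of_ne_finset_zero fun i hi => ?_
  rw [coeff_eq_zero_of_natDegree_lt (by simpa using hi)]
  simp

theorem sum_antidiagonal_coeff_eulerPoly_mul_localTerm (f : MonicIrred F) (m : ℕ) :
    ∑ p ∈ Finset.HasAntidiagonal.antidiagonal m,
      toLaurent _ (baseChange n ((eulerPoly φ f).coeff p.1)) * evalRatio n f ^ p.1 *
        localTerm n φ f p.2 = if m = 0 then 1 else 0 := by
  have hcoeff := congrArg (fun b => toLaurent _ (baseChange n (PowerSeries.coeff m b)) *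
    evalRatio n f ^ m) (eulerPoly_mul_eulerSeries φ f)
  simp only [PowerSeries.coeff_mul, PowerSeries.coeff_one, Polynomial.coeff_coe, baseChange,
    Polynomial.map_sum, map_sum, Finset.sum_mul] at hcoeff
  refine Eq.trans (Finset.sum_congr rfl fun p hp => ?_) (hcoeff.trans ?_)
  · rw [localTerm, ← Finset.HasAntidiagonal.mem_antidiagonal.mp hp, Polynomial.map_mul, map_mul,
      pow_add, baseChange, baseChange]
    ring
  · split_ifs with hm
    · simp [hm]
    · simp

theorem summable_localTerm (f : MonicIrred F) : Summable (localTerm n φ f) := by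
  refine ((summable_seriesTerm n φ).comp_injective (i := fun i => factorProd (Finsupp.single f i))
    (factorEquiv.injective.comp (Finsupp.single_injective f))).congr fun i => ?_
  rw [Function.comp_apply, seriesTerm_factorProd, Finsupp.prod_single_index (localTerm_zero n φ f)]

theorem hasSum_localTerm (f : MonicIrred F) : HasSum (localTerm n φ f) (taelmanFactor n φ f) := by
  have hmul : (taelmanFactor n φ f)⁻¹ * ∑' i, localTerm n φ f i = 1 := by
    rw [← (hasSum_eulerPoly n φ f).tsum_eq]
    exact tsum_mul_tsum_eq_one (hasSum_eulerPoly n φ f).summable (summable_localTerm n φ f)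
      (sum_antidiagonal_coeff_eulerPoly_mul_localTerm n φ f)
  rw [← inv_inv (taelmanFactor n φ f), ← eq_inv_of_mul_eq_one_right hmul]
  exact (summable_localTerm n φ f).hasSum

theorem hasProd_taelmanFactor : HasProd (taelmanFactor n φ) (∑' a, seriesTerm n φ a) := by
  refine hasProd_of_hasSum_finsupp_prod (localTerm_zero n φ) (hasSum_localTerm n φ) ?_
  refine ((factorEquiv.hasSum_iff.mpr (summable_seriesTerm n φ).hasSum)).congr_fun fun m => ?_
  exact (seriesTerm_factorProd n φ m).symm

end Expansion

end TaelmanL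

end

theorem mainTheorem7 {F : Type*} [Field F] [Fintype F] (n : ℕ) (φ : TaelmanL.DrinfeldModule F) :
    Multipliable (TaelmanL.taelmanFactor n φ) ∧
      HasSum (TaelmanL.seriesTerm n φ) (TaelmanL.taelmanLValue n φ) := by
  have hprod := TaelmanL.hasProd_taelmanFactor n φ
  refine ⟨hprod.multipliable, ?_⟩
  rw [TaelmanL.taelmanLValue, hprod.tprod_eq]
  exact (TaelmanL.summable_seriesTerm n φ).hasSum
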